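/- **Conventions.** $M_{k,l}$ denotes the complex $k\times l$ matrices with the operator norm, $M_k=M_{k,k}$, and $k,l,r,s,p,j,n$ (and $q$ in (a)) range over $\{1,2,\dots\}$; $\varepsilon^{[k]}_{i,j}\in M_k$ is the matrix unit, with $\varepsilon^{[k]}_{i,j}=0$ if $(i,j)\notin\{1,\dots,k\}^2$, and $\varepsilon_j^{[k]}=\varepsilon_{j,j}^{[k]}$. Operator spaces are complex vector spaces $V$ with norms $\|\cdot\|_n$ on $M_n(V)$ satisfying Ruan's axioms; they are not assumed complete. If $V$ has an involution, then $M_n(V)$ has the involution $(v_{ij})^*=(v_{ji}^*)$. A *matrix ordered operator space* is an operator space $V$ with a conjugate-linear involution and cones $M_n(V)^+\subseteq M_n(V)_{sa}$ such that $A^*M_n(V)^+A\subseteq M_p(V)^+$ for $A\in M_{n,p}$, the involution is isometric on each $M_n(V)$, and each $M_n(V)^+$ is norm closed. It is *matrix regular* if for all $n$ and all $v\in M_n(V)_{sa}$: (1) if $u\in M_n(V)^+$ and $-u\le v\le u$, then $\|v\|_n\le\|u\|_n$; (2) if $\|v\|_n<1$, then there is $u\in M_n(V)^+$ with $\|u\|_n<1$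 and $-u\le v\le u$. **Matrix products.** Let $m\ge1$ and let $\lambda=(\lambda_k)_{k\ge1}$ be a sequence of $m$-linear maps $\lambda_k:M_k\times\dots\times M_k\to M_{\tau(k)}$. For an $m$-linear map $\phi:V_1\times\dots\times V_m\to W$ let $\phi_{\lambda_k}:M_k(V_1)\times\dots\times M_k(V_m)\to M_{\tau(k)}(W)$ be the $m$-linear map with $(\alpha_1\otimes v_1,\dots,\alpha_m\otimes v_m)\mapsto\lambda_k(\alpha_1,\dots,\alpha_m)\otimes\phi(v_1,\dots,v_m)$; for $\phi=\otimes$, the canonical map into the algebraic tensor product $\bigotimes V_i=V_1\otimes\dots\otimes V_m$, write $\otimes_{\lambda_k}$. Assume: * (E1) For every $k$ there are $p$, $S\in M_{k,\tau(p)}$, $T\in M_{\tau(p),k}$ and $a_1,\dots,a_k\in M_p$ such that $S\lambda_p(a_{j_1},\dots,a_{j_m})T=\varepsilon^{[k]}_{j}$ if $j_1=\dots=j_m=j$, and $=0$ if $j_1,\dots,j_m\in\{1,\dots,k\}$ are not all equal. * (E2) For all $r,s$ there is $P\in M_{\tau(r)+\tau(s),\tau(r+s)}$ with $\|P\|\le1$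 such that for all $(i_t,j_t)\in\{1,\dots,r\}^2\cup\{r+1,\dots,r+s\}^2$, $1\le t\le m$, $$P\lambda_{r+s}(\varepsilon^{[r+s]}_{i_1,j_1},\dots,\varepsilon^{[r+s]}_{i_m,j_m})P^*=\begin{pmatrix}\lambda_r(\varepsilon^{[r]}_{i_1,j_1},\dots,\varepsilon^{[r]}_{i_m,j_m})&0\\0&\lambda_s(\varepsilon^{[s]}_{i_1-r,j_1-r},\dots,\varepsilon^{[s]}_{i_m-r,j_m-r})\end{pmatrix}.$$ * (E3) $\lambda_1(1,\dots,1)=1$ and $\sup_k\|\lambda_k\|<\infty$. * (O1) $\lambda_r(\varepsilon^{[r]}_{i_1,j_1},\dots,\varepsilon^{[r]}_{i_m,j_m})=\lambda_r(\varepsilon^{[r]}_{j_1,i_1},\dots,\varepsilon^{[r]}_{j_m,i_m})^*$ for all $r$ and all $(i_t,j_t)\in\{1,\dots,r\}^2$. * (O2) For every $r$ the matrix $P$ in (E2) with $s=r$ can be chosen such that in addition, for all $(i_t,j_t)\in\big(\{1,\dots,r\}\times\{r+1,\dots,2r\}\big)\cup\big(\{r+1,\dots,2r\}\times\{1,\dots,r\}\big)$,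 $1\le t\le m$, $$P\lambda_{2r}(\varepsilon^{[2r]}_{i_1,j_1},\dots,\varepsilon^{[2r]}_{i_m,j_m})P^*=\begin{pmatrix}0&\lambda_r(\varepsilon^{[r]}_{i_1,j_1-r},\dots,\varepsilon^{[r]}_{i_m,j_m-r})\\\lambda_r(\varepsilon^{[r]}_{i_1-r,j_1},\dots,\varepsilon^{[r]}_{i_m-r,j_m})&0\end{pmatrix}.$$ * (O3) For all $r,p_1,\dots,p_m$, with $\kappa:M_{p_1}\times\dots\times M_{p_m}\to M_{p_1\cdots p_m}$ the Kronecker product, the map $\kappa_{\lambda_r}:M_r(M_{p_1})\times\dots\times M_r(M_{p_m})\to M_{\tau(r)}(M_{p_1\cdots p_m})$ is positive, i.e. it sends $m$-tuples of positive semidefinite matrices to positive semidefinite matrices. **Norms and cones.** Let $V_1,\dots,V_m$ be matrix regular operator spaces, and give $\bigotimes V_i$ the involution $(v_1\otimes\dots\otimes v_m)^*=v_1^*\otimes\dots\otimes v_m^*$. For $u,z\in M_n(\bigotimes V_i)$ put $$\|u\|_{\lambda,n}=\inf\{\|\alpha\|\|v_1\|\cdots\|v_m\|\|\beta\|:\ u=\alpha\otimes_{\lambda_j}(v_1,\dots,v_m)\beta,\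 j\ge1,\ \alpha\in M_{n,\tau(j)},\ \beta\in M_{\tau(j),n},\ v_t\in M_j(V_t)\},$$ $$\mathcal C_n=\{\alpha\otimes_{\lambda_j}(v_1,\dots,v_m)\alpha^*:\ j\ge1,\ \alpha\in M_{n,\tau(j)},\ v_t\in M_j(V_t)^+\},$$ $$\|z\|_{\Lambda,n}=\inf\Big\{\max\{\|u\|_{\lambda,n},\|u'\|_{\lambda,n}\}:\ \begin{pmatrix}u&z\\z^*&u'\end{pmatrix}\in\mathcal C_{2n}\Big\},$$ and let $M_n(\otimes_\Lambda V_i)^+$ be the closure of $\mathcal C_n$ with respect to $\|\cdot\|_{\Lambda,n}$. **Theorem.** Let $\lambda$ satisfy (E1)–(E3) and (O1)–(O3), and let $V_1,\dots,V_m$ be matrix regular operator spaces. (a) $\big(\bigotimes V_i,\{\|\cdot\|_{\Lambda,n}\}_{n},\{M_n(\otimes_\Lambda V_i)^+\}_{n}\big)$ is a matrix regular operator space. In particular each $\|\cdot\|_{\Lambda,n}$ is a norm, and $\|v\oplus w\|_{\Lambda,n+q}=\max\{\|v\|_{\Lambda,n},\|w\|_{\Lambda,q}\}$ and $\|\alpha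 v\beta\|_{\Lambda,q}\le\|\alpha\|\|v\|_{\Lambda,n}\|\beta\|$ for $v\in M_n(\bigotimes V_i)$, $w\in M_q(\bigotimes V_i)$, $\alpha\in M_{q,n}$, $\beta\in M_{n,q}$. (b) The norms are $\lambda$-subcross: $\|\otimes_{\lambda_j}(v_1,\dots,v_m)\|_{\Lambda,\tau(j)}\le\|v_1\|\cdots\|v_m\|$ for all $j\ge1$ and $v_t\in M_j(V_t)$. -/

import Mathlib

open scoped TensorProduct

noncomputable section

namespace LambdaTensor

/-! ### The involution on an algebraic tensor product of complex `*`-vector spaces -/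

section Involution

variable {ι : Type*} {V : ι → Type*} [∀ t, AddCommGroup (V t)] [∀ t, Module ℂ (V t)]
  [∀ t, StarAddMonoid (V t)] [∀ t, StarModule ℂ (V t)]

/-- The additive map with `c • (v₁ ⊗ ⋯ ⊗ vₘ) ↦ conj c • (v₁* ⊗ ⋯ ⊗ vₘ*)`. -/
def tensorStar : (⨂[ℂ] t, V t) →+ (⨂[ℂ] t, V t) :=
  PiTensorProduct.liftAddHom
    (fun p : ℂ × (∀ t, V t) => star p.1 • PiTensorProduct.tprod ℂ (fun t => star (p.2 t)))
    (by
      intro r f i hf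
      have h : (PiTensorProduct.tprod ℂ (fun t => star (f t)) : ⨂[ℂ] t, V t) = 0 :=
        (PiTensorProduct.tprod ℂ).map_coord_zero i (by simp [hf])
      simp [h])
    (by intro f; simp)
    (by
      intro _ r f i v w
      have key : ∀ x : V i, (fun t => star (Function.update f i x t))
          = Function.update (fun t => star (f t)) i (star x) := by
        intro x
        funext t
        by_cases h : t = i
        · subst h; simp
        · simp [Function.update_of_ne h]
      simp only [key, star_add, MultilinearMap.map_update_add, smul_add])
    (by intro r r' f; simp [add_smul])
    (by
      intro _ r f i r'
      have key : (fun t => star (Function.update f i (r' • f i) t))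
          = Function.update (fun t => star (f t)) i (star r' • star (f i)) := by
        funext t
        by_cases h : t = i
        · subst h; simp [star_smul]
        · simp [Function.update_of_ne h]
      simp only [key, MultilinearMap.map_update_smul, Function.update_eq_self, smul_smul,
        star_mul', mul_comm])

theorem tensorStar_smul_tprod (c : ℂ) (f : ∀ t, V t) :
    tensorStar (c • PiTensorProduct.tprod ℂ f)
      = star c • PiTensorProduct.tprod ℂ (fun t => star (f t)) := by
  rw [← PiTensorProduct.tprodCoeff_eq_smul_tprod]
  rfl

/-- The standard involution of the algebraic tensor product,
`(v₁ ⊗ ⋯ ⊗ vₘ)* = v₁* ⊗ ⋯ ⊗ vₘ*`, extended conjugate-linearly. -/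
instance instStarAddMonoidTensor : StarAddMonoid (⨂[ℂ] t, V t) where
  star := tensorStar
  star_involutive := by
    intro z
    induction z using PiTensorProduct.induction_on with
    | smul_tprod r f => simp only [tensorStar_smul_tprod, star_star]
    | add x y hx hy => rw [map_add, map_add, hx, hy]
  star_add := map_add _

instance instStarModuleTensor : StarModule ℂ (⨂[ℂ] t, V t) where
  star_smul := by
    intro c z
    change tensorStar (c • z) = star c • tensorStar z
    induction z using PiTensorProduct.induction_on with
    | smul_tprod r f => rw [smul_smul, tensorStar_smul_tprod, tensorStar_smul_tprod, star_mul',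
        smul_smul]
    | add x y hx hy => rw [smul_add, map_add, map_add, hx, hy, smul_add]

theorem star_tprod (f : ∀ t, V t) :
    star (PiTensorProduct.tprod ℂ f : ⨂[ℂ] t, V t)
      = PiTensorProduct.tprod ℂ (fun t => star (f t)) := by
  have h := tensorStar_smul_tprod (1 : ℂ) f
  rw [one_smul, star_one, one_smul] at h
  exact h

end Involution

/-! ### Matrices over a vector space -/

section OpNorm

open scoped Matrix.Norms.L2Operator

/-- The norm of a scalar matrix as an operator between the Hilbert spaces `ℂᵠ` and `ℂᵖ`. -/
def opNorm {I J : Type*} [Fintype I] [Fintype J] [DecidableEq J] (A : Matrix I J ℂ) : ℝ := ‖A‖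

end OpNorm

section MatrixSpaces

variable {V : Type*} [AddCommGroup V] [Module ℂ V]

/-- The product `α v β` of a matrix over `V` with scalar matrices. -/
def sandwich {p q : ℕ} (α : Matrix (Fin p) (Fin q) ℂ) (v : Matrix (Fin q) (Fin q) V)
    (β : Matrix (Fin q) (Fin p) ℂ) : Matrix (Fin p) (Fin p) V :=
  Matrix.of fun i j => ∑ k, ∑ l, (α i k * β l j) • v k l

/-- The block matrix with rows `(A B)` and `(C D)`, as an element of `M_{p+q}(V)`. -/
def blockMat {p q : ℕ} (A : Matrix (Fin p) (Fin p) V) (B : Matrix (Fin p) (Fin q) V)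
    (C : Matrix (Fin q) (Fin p) V) (D : Matrix (Fin q) (Fin q) V) :
    Matrix (Fin (p + q)) (Fin (p + q)) V :=
  Matrix.reindex finSumFinEquiv finSumFinEquiv (Matrix.fromBlocks A B C D)

/-- The closure of `S` with respect to the (semi)norm `N`. -/
def normClosure {E : Type*} [AddCommGroup E] (N : E → ℝ) (S : Set E) : Set E :=
  {z | ∀ ε : ℝ, 0 < ε → ∃ c ∈ S, N (z - c) < ε}

/-- `(V, (N n))` is an (abstract, not necessarily complete) operator space: every `N n` is a
norm on `M_n(V)` and Ruan's axioms hold. -/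
structure IsOperatorSpace (N : ∀ n : ℕ, Matrix (Fin n) (Fin n) V → ℝ) : Prop where
  add_le : ∀ n (v w : Matrix (Fin n) (Fin n) V), N n (v + w) ≤ N n v + N n w
  smul_eq : ∀ n (c : ℂ) (v : Matrix (Fin n) (Fin n) V), N n (c • v) = ‖c‖ * N n v
  eq_zero : ∀ n (v : Matrix (Fin n) (Fin n) V), N n v = 0 → v = 0
  sum_eq : ∀ p q (v : Matrix (Fin p) (Fin p) V) (w : Matrix (Fin q) (Fin q) V),
    N (p + q) (blockMat v 0 0 w) = max (N p v) (N q w)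
  sandwich_le : ∀ p q (α : Matrix (Fin p) (Fin q) ℂ) (v : Matrix (Fin q) (Fin q) V)
    (β : Matrix (Fin q) (Fin p) ℂ), N p (sandwich α v β) ≤ opNorm α * N q v * opNorm β

variable [StarAddMonoid V] [StarModule ℂ V]

/-- `(V, (N n), (K n))` is a matrix ordered operator space; the involution of `M_n(V)` is
`(v_{ij})* = (v_{ji}*)`. -/
structure IsMatrixOrderedOperatorSpace (N : ∀ n : ℕ, Matrix (Fin n) (Fin n) V → ℝ)
    (K : ∀ n : ℕ, Set (Matrix (Fin n) (Fin n) V)) : Prop extends IsOperatorSpace N where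
  isSelfAdjoint : ∀ n, ∀ v ∈ K n, v.conjTranspose = v
  zero_mem : ∀ n, (0 : Matrix (Fin n) (Fin n) V) ∈ K n
  add_mem : ∀ n, ∀ v ∈ K n, ∀ w ∈ K n, v + w ∈ K n
  smul_mem : ∀ n, ∀ r : ℝ, 0 ≤ r → ∀ v ∈ K n, (r : ℂ) • v ∈ K n
  conj_mem : ∀ n p (A : Matrix (Fin n) (Fin p) ℂ), ∀ v ∈ K n,
    sandwich A.conjTranspose v A ∈ K p
  star_isometry : ∀ n (v : Matrix (Fin n) (Fin n) V), N n v.conjTranspose = N n v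
  closed : ∀ n, normClosure (N n) (K n) ⊆ K n

/-- A matrix ordered operator space is matrix regular if, for self-adjoint `v ∈ M_n(V)`,
`-u ≤ v ≤ u` implies `‖v‖ ≤ ‖u‖`, and `‖v‖ < 1` implies `-u ≤ v ≤ u` for some `u ≥ 0` with
`‖u‖ < 1`. -/
structure IsMatrixRegular (N : ∀ n : ℕ, Matrix (Fin n) (Fin n) V → ℝ)
    (K : ∀ n : ℕ, Set (Matrix (Fin n) (Fin n) V)) : Prop
    extends IsMatrixOrderedOperatorSpace N K where
  norm_le : ∀ n (v : Matrix (Fin n) (Fin n) V), v.conjTranspose = v →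
    ∀ u ∈ K n, v + u ∈ K n → u - v ∈ K n → N n v ≤ N n u
  exists_dominating : ∀ n (v : Matrix (Fin n) (Fin n) V), v.conjTranspose = v → N n v < 1 →
    ∃ u ∈ K n, N n u < 1 ∧ v + u ∈ K n ∧ u - v ∈ K n

end MatrixSpaces

/-! ### Sequences of matrix products -/

/-- A sequence `λ = (λ_k)` of `m`-linear maps `λ_k : M_k × ⋯ × M_k → M_{τ(k)}`; only the
indices `k ≥ 1` are ever used. -/
structure MatrixProducts (m : ℕ) where
  τ : ℕ → ℕ
  prod : ∀ k : ℕ, MultilinearMap ℂ (fun _ : Fin m => Matrix (Fin k) (Fin k) ℂ)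
    (Matrix (Fin (τ k)) (Fin (τ k)) ℂ)

/-- The map `λ ⊗ φ : M_k(V₁) × ⋯ × M_k(Vₘ) → M_q(W)` obtained by tensorizing a scalar matrix
product `λ` with `φ`, i.e. the multilinear map with
`(α₁ ⊗ v₁, …, αₘ ⊗ vₘ) ↦ λ(α₁, …, αₘ) ⊗ φ(v₁, …, vₘ)`, written in matrix units. -/
def amplify {m k q : ℕ} {V : Fin m → Type*} {W : Type*} [∀ t, AddCommGroup (V t)]
    [∀ t, Module ℂ (V t)] [AddCommGroup W] [Module ℂ W]
    (lam : MultilinearMap ℂ (fun _ : Fin m => Matrix (Fin k) (Fin k) ℂ)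
      (Matrix (Fin q) (Fin q) ℂ))
    (φ : MultilinearMap ℂ V W) (v : ∀ t, Matrix (Fin k) (Fin k) (V t)) :
    Matrix (Fin q) (Fin q) W :=
  Matrix.of fun a b => ∑ i : Fin m → Fin k, ∑ j : Fin m → Fin k,
    lam (fun t => Matrix.single (i t) (j t) (1 : ℂ)) a b • φ (fun t => v t (i t) (j t))

/-- The `m`-fold Kronecker product `M_{p₁} × ⋯ × M_{pₘ} → M_{p₁⋯pₘ}`; the rows and columns of
the product are indexed by `{1,…,p₁} × ⋯ × {1,…,pₘ}`. -/
def kronecker {m : ℕ} (p : Fin m → ℕ) :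
    MultilinearMap ℂ (fun t => Matrix (Fin (p t)) (Fin (p t)) ℂ)
      (Matrix (∀ t, Fin (p t)) (∀ t, Fin (p t)) ℂ) where
  toFun α := Matrix.of fun a b => ∏ t, α t (a t) (b t)
  map_update_add' := by
    intro _ α i x y
    ext a b
    have h : ∀ z : Matrix (Fin (p i)) (Fin (p i)) ℂ,
        (∏ t, Function.update α i z t (a t) (b t))
          = z (a i) (b i) * ∏ t ∈ Finset.univ.erase i, α t (a t) (b t) := by
      intro z
      rw [← Finset.mul_prod_erase Finset.univ _ (Finset.mem_univ i), Function.update_self]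
      congr 1
      refine Finset.prod_congr rfl fun t ht => ?_
      rw [Function.update_of_ne (Finset.ne_of_mem_erase ht)]
    simp only [Matrix.of_apply, Matrix.add_apply, h, add_mul]
  map_update_smul' := by
    intro _ α i c x
    ext a b
    have h : ∀ z : Matrix (Fin (p i)) (Fin (p i)) ℂ,
        (∏ t, Function.update α i z t (a t) (b t))
          = z (a i) (b i) * ∏ t ∈ Finset.univ.erase i, α t (a t) (b t) := by
      intro z
      rw [← Finset.mul_prod_erase Finset.univ _ (Finset.mem_univ i), Function.update_self]
      congr 1
      refine Finset.prod_congr rfl fun t ht => ?_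
      rw [Function.update_of_ne (Finset.ne_of_mem_erase ht)]
    simp only [Matrix.of_apply, Matrix.smul_apply, h, smul_eq_mul, mul_assoc]

/-- The matrix unit `ε_{i,j}^{[k]} ∈ M_k` (indices counted from `1`), which is `0` if `(i,j)`
lies outside `{1,…,k} × {1,…,k}`. -/
def eps (k : ℕ) (i j : ℤ) : Matrix (Fin k) (Fin k) ℂ :=
  Matrix.of fun a b => if (a : ℤ) + 1 = i ∧ (b : ℤ) + 1 = j then 1 else 0

namespace MatrixProducts

variable {m : ℕ} (L : MatrixProducts m)

/-- Condition (E1). -/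
def E1 : Prop :=
  ∀ k : ℕ, 0 < k → ∃ p : ℕ, 0 < p ∧
    ∃ (S : Matrix (Fin k) (Fin (L.τ p)) ℂ) (T : Matrix (Fin (L.τ p)) (Fin k) ℂ)
      (a : Fin k → Matrix (Fin p) (Fin p) ℂ), ∀ j : Fin m → Fin k,
      (∀ c : Fin k, (∀ t, j t = c) →
        S * L.prod p (fun t => a (j t)) * T = Matrix.single c c (1 : ℂ)) ∧
      ((¬ ∃ c : Fin k, ∀ t, j t = c) → S * L.prod p (fun t => a (j t)) * T = 0)

/-- The identity of condition (E2) for the matrix `P ∈ M_{τ(r)+τ(s), τ(r+s)}`. -/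
def DiagIdentity (r s : ℕ) (P : Matrix (Fin (L.τ r) ⊕ Fin (L.τ s)) (Fin (L.τ (r + s))) ℂ) :
    Prop :=
  ∀ i j : Fin m → ℤ,
    (∀ t, (i t ∈ Set.Icc (1 : ℤ) r ∧ j t ∈ Set.Icc (1 : ℤ) r) ∨
      (i t ∈ Set.Icc (r + 1 : ℤ) (r + s) ∧ j t ∈ Set.Icc (r + 1 : ℤ) (r + s))) →
    P * L.prod (r + s) (fun t => eps (r + s) (i t) (j t)) * P.conjTranspose =
      Matrix.fromBlocks (L.prod r fun t => eps r (i t) (j t)) 0 0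
        (L.prod s fun t => eps s (i t - r) (j t - r))

/-- Condition (E2). -/
def E2 : Prop :=
  ∀ r s : ℕ, 0 < r → 0 < s →
    ∃ P : Matrix (Fin (L.τ r) ⊕ Fin (L.τ s)) (Fin (L.τ (r + s))) ℂ,
      opNorm P ≤ 1 ∧ L.DiagIdentity r s P

/-- Condition (E3): `λ₁(1,…,1) = 1` and `sup_k ‖λ_k‖ < ∞`. -/
def E3 : Prop :=
  L.prod 1 (fun _ => 1) = 1 ∧
    ∃ C : ℝ, ∀ k : ℕ, 0 < k → ∀ α : Fin m → Matrix (Fin k) (Fin k) ℂ,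
      opNorm (L.prod k α) ≤ C * ∏ t, opNorm (α t)

/-- Condition (O1). -/
def O1 : Prop :=
  ∀ r : ℕ, 0 < r → ∀ i j : Fin m → Fin r,
    L.prod r (fun t => Matrix.single (i t) (j t) (1 : ℂ)) =
      (L.prod r (fun t => Matrix.single (j t) (i t) (1 : ℂ))).conjTranspose

/-- The identity of condition (O2) for the matrix `P ∈ M_{2τ(r), τ(2r)}`. -/
def AntidiagIdentity (r : ℕ)
    (P : Matrix (Fin (L.τ r) ⊕ Fin (L.τ r)) (Fin (L.τ (r + r))) ℂ) : Prop :=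
  ∀ i j : Fin m → ℤ,
    (∀ t, (i t ∈ Set.Icc (1 : ℤ) r ∧ j t ∈ Set.Icc (r + 1 : ℤ) (r + r)) ∨
      (i t ∈ Set.Icc (r + 1 : ℤ) (r + r) ∧ j t ∈ Set.Icc (1 : ℤ) r)) →
    P * L.prod (r + r) (fun t => eps (r + r) (i t) (j t)) * P.conjTranspose =
      Matrix.fromBlocks 0 (L.prod r fun t => eps r (i t) (j t - r))
        (L.prod r fun t => eps r (i t - r) (j t)) 0

/-- Condition (O2): a matrix `P` as in (E2), with `s = r`, also satisfies the antidiagonal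
identity. -/
def O2 : Prop :=
  ∀ r : ℕ, 0 < r →
    ∃ P : Matrix (Fin (L.τ r) ⊕ Fin (L.τ r)) (Fin (L.τ (r + r))) ℂ,
      opNorm P ≤ 1 ∧ L.DiagIdentity r r P ∧ L.AntidiagIdentity r P

open scoped ComplexOrder in
/-- Condition (O3): tensorizing `λ_r` with Kronecker products gives positive maps
`M_r(M_{p₁}) × ⋯ × M_r(M_{pₘ}) → M_{τ(r)}(M_{p₁⋯pₘ})`; the positive elements of `M_r(M_p)` are
those that are positive semidefinite as matrices of size `rp`. -/
def O3 : Prop :=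
  ∀ r : ℕ, 0 < r → ∀ p : Fin m → ℕ,
    ∀ x : ∀ t, Matrix (Fin r) (Fin r) (Matrix (Fin (p t)) (Fin (p t)) ℂ),
      (∀ t, (Matrix.comp _ _ _ _ _ (x t)).PosSemidef) →
      (Matrix.comp _ _ _ _ _ (amplify (L.prod r) (kronecker p) x)).PosSemidef

/-! ### Norms and cones on the algebraic tensor product -/

variable {V : Fin m → Type*} [∀ t, AddCommGroup (V t)] [∀ t, Module ℂ (V t)]

/-- The map `⊗_{λ_j} : M_j(V₁) × ⋯ × M_j(Vₘ) → M_{τ(j)}(V₁ ⊗ ⋯ ⊗ Vₘ)`. -/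
def tensor (j : ℕ) (v : ∀ t, Matrix (Fin j) (Fin j) (V t)) :
    Matrix (Fin (L.τ j)) (Fin (L.τ j)) (⨂[ℂ] t, V t) :=
  amplify (L.prod j) (PiTensorProduct.tprod ℂ) v

/-- The norm `‖u‖_{λ,n}`: the infimum of `‖α‖ ‖v₁‖ ⋯ ‖vₘ‖ ‖β‖` over all representations
`u = α ⊗_{λ_j} (v₁, …, vₘ) β`. -/
def lambdaNorm (N : ∀ t, ∀ n : ℕ, Matrix (Fin n) (Fin n) (V t) → ℝ) (n : ℕ)
    (u : Matrix (Fin n) (Fin n) (⨂[ℂ] t, V t)) : ℝ :=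
  sInf {c : ℝ | ∃ (j : ℕ) (α : Matrix (Fin n) (Fin (L.τ j)) ℂ)
    (v : ∀ t, Matrix (Fin j) (Fin j) (V t)) (β : Matrix (Fin (L.τ j)) (Fin n) ℂ),
    0 < j ∧ u = sandwich α (L.tensor j v) β ∧
      c = opNorm α * (∏ t, N t j (v t)) * opNorm β}

/-- The cone `C_n` of all `α ⊗_{λ_j} (v₁, …, vₘ) α*` with `v_t ∈ M_j(V_t)⁺`. -/
def cone (K : ∀ t, ∀ n : ℕ, Set (Matrix (Fin n) (Fin n) (V t))) (n : ℕ) :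
    Set (Matrix (Fin n) (Fin n) (⨂[ℂ] t, V t)) :=
  {u | ∃ (j : ℕ) (α : Matrix (Fin n) (Fin (L.τ j)) ℂ)
    (v : ∀ t, Matrix (Fin j) (Fin j) (V t)),
    0 < j ∧ (∀ t, v t ∈ K t j) ∧ u = sandwich α (L.tensor j v) α.conjTranspose}

variable [∀ t, StarAddMonoid (V t)] [∀ t, StarModule ℂ (V t)]

/-- The norm `‖z‖_{Λ,n}`: the infimum of `max (‖u‖_{λ,n}) (‖u'‖_{λ,n})` over all `u, u'` for which
the block matrix with rows `(u z)`, `(z* u')` lies in `C_{2n}`. -/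
def bigLambdaNorm (N : ∀ t, ∀ n : ℕ, Matrix (Fin n) (Fin n) (V t) → ℝ)
    (K : ∀ t, ∀ n : ℕ, Set (Matrix (Fin n) (Fin n) (V t))) (n : ℕ)
    (z : Matrix (Fin n) (Fin n) (⨂[ℂ] t, V t)) : ℝ :=
  sInf {c : ℝ | ∃ u u' : Matrix (Fin n) (Fin n) (⨂[ℂ] t, V t),
    blockMat u z z.conjTranspose u' ∈ L.cone K (n + n) ∧
      c = max (L.lambdaNorm N n u) (L.lambdaNorm N n u')}

/-- The cone `M_n(⊗_Λ V_t)⁺`, the closure of `C_n` with respect to `‖·‖_{Λ,n}`. -/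
def closedCone (N : ∀ t, ∀ n : ℕ, Matrix (Fin n) (Fin n) (V t) → ℝ)
    (K : ∀ t, ∀ n : ℕ, Set (Matrix (Fin n) (Fin n) (V t))) (n : ℕ) :
    Set (Matrix (Fin n) (Fin n) (⨂[ℂ] t, V t)) :=
  normClosure (L.bigLambdaNorm N K n) (L.cone K n)

/-- A family of norms on the spaces `M_n(V₁ ⊗ ⋯ ⊗ Vₘ)` is `λ`-subcross if
`‖⊗_{λ_j}(v₁, …, vₘ)‖_{τ(j)} ≤ ‖v₁‖ ⋯ ‖vₘ‖` for all `j` and `v_t ∈ M_j(V_t)`. -/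
def IsSubcross (N : ∀ t, ∀ n : ℕ, Matrix (Fin n) (Fin n) (V t) → ℝ)
    (M : ∀ n : ℕ, Matrix (Fin n) (Fin n) (⨂[ℂ] t, V t) → ℝ) : Prop :=
  ∀ j : ℕ, 0 < j → ∀ v : ∀ t, Matrix (Fin j) (Fin j) (V t),
    M (L.τ j) (L.tensor j v) ≤ ∏ t, N t j (v t)

end MatrixProducts

end LambdaTensor

end

/-! Two gauges interact. The gauge `‖·‖_λ` is built from factorizations, and `‖·‖_Λ` measures an
element as the off-diagonal corner of a positive `2 × 2` block whose diagonal has small `‖·‖_λ`. The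
gauge `‖·‖_λ` obeys Ruan's axioms: (E1) at `k = 1` makes every matrix factorizable, and (E2) merges
two factorizations into one of their direct sum (`ruanFamily_lambdaNormOn`). The same axioms pass to
`‖·‖_Λ` by conjugating positive blocks with block-diagonal scalar matrices
(`ruanFamily_bigLambdaNormOn`); the triangle inequality is a consequence of the compression and
direct sum rules.

The subcross estimate, and the finiteness of `‖·‖_Λ`, need a positive block around `⊗_λ(v₁, …, vₘ)`.
Regularity of `V_t` gives a positive block with diagonal `a_t`, `b_t` and off-diagonal `v_t`, `v_t*`
(`exists_blockMat_mem`). The identities in (E2) and (O2) only evaluate products whose factors are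
all diagonal or all antidiagonal. The mixed terms are removed by averaging over signs: flip the
off-diagonal of the `t`-th block by `s_t = ±1` and sum with weights `1 + ∏ s_t ≥ 0`. The weights
keep the cone and cancel exactly the mixed terms (`fromBlocks_tensor_mem_coneOn`).

Definiteness uses bounded positive functionals `f_t`. By (O3) their tensor product sends the cone to
positive semidefinite matrices, and by (E3) it is bounded for `‖·‖_λ`. A `2 × 2` minor then bounds
the values on the corner `z` by those on the diagonal, so they vanish when `‖z‖_Λ = 0`
(`eq_zero_of_fromBlocks_mem`). Hahn–Banach on the closed pointed cones `K 1` yields enough such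
functionals to separate points of each `V_t`, hence of the algebraic tensor product.

Regularity rests on passing between `-u ≤ v ≤ u` and positive blocks with off-diagonal `v`: adding
conjugates of `u ± v` produces the block, and compressing a block by `(1 ±1)` produces a dominating
`u` (`bigLambdaNormOn_le_of_dominated`, `exists_dominating_of_lt`). Passing to the closed cone costs
an `ε`-approximation. -/

noncomputable section

namespace LambdaTensor

set_option linter.unusedSectionVars false

section

open scoped Matrix.Norms.L2Operator Matrix

/-! ### The operator norm of scalar matrices. -/

section OpNormLemmas

variable {I J K L : Type*} [Fintype I] [Fintype J] [Fintype K] [Fintype L]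
  [DecidableEq I] [DecidableEq J] [DecidableEq K] [DecidableEq L]

theorem opNorm_nonneg (A : Matrix I J ℂ) : 0 ≤ opNorm A := norm_nonneg _

theorem opNorm_mul_le (A : Matrix I J ℂ) (B : Matrix J K ℂ) :
    opNorm (A * B) ≤ opNorm A * opNorm B := Matrix.l2_opNorm_mul A B

theorem opNorm_conjTranspose (A : Matrix I J ℂ) : opNorm Aᴴ = opNorm A :=
  Matrix.l2_opNorm_conjTranspose A

theorem opNorm_smul (c : ℂ) (A : Matrix I J ℂ) : opNorm (c • A) = ‖c‖ * opNorm A :=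
  norm_smul c A

theorem opNorm_zero : opNorm (0 : Matrix I J ℂ) = 0 := norm_zero

theorem eq_zero_of_opNorm_eq_zero {A : Matrix I J ℂ} (h : opNorm A = 0) : A = 0 :=
  norm_eq_zero.1 h

theorem opNorm_mul_self_eq (A : Matrix I J ℂ) : opNorm A * opNorm A = opNorm (Aᴴ * A) :=
  (Matrix.l2_opNorm_conjTranspose_mul_self A).symm

theorem opNorm_one_le : opNorm (1 : Matrix I I ℂ) ≤ 1 := by
  have h : opNorm (1 : Matrix I I ℂ) = ‖(fun _ => 1 : I → ℂ)‖ := by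
    rw [← Matrix.l2_opNorm_diagonal]; rfl
  rw [h]
  exact (pi_norm_le_iff_of_nonneg zero_le_one).2 fun _ => by simp

theorem opNorm_le_one_of_conjTranspose_mul_self {A : Matrix I J ℂ} (h : Aᴴ * A = 1) :
    opNorm A ≤ 1 := by
  have h1 := opNorm_mul_self_eq A
  rw [h] at h1
  nlinarith [opNorm_nonneg A, opNorm_one_le (I := J)]

theorem opNorm_le_one_of_mul_conjTranspose_self {A : Matrix I J ℂ} (h : A * Aᴴ = 1) :
    opNorm A ≤ 1 := by
  rw [← opNorm_conjTranspose]
  exact opNorm_le_one_of_conjTranspose_mul_self (by rwa [Matrix.conjTranspose_conjTranspose])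

theorem sum_norm_sq_mulVec_le (A : Matrix I J ℂ) (x : J → ℂ) :
    ∑ i, ‖(A *ᵥ x) i‖ ^ 2 ≤ opNorm A ^ 2 * ∑ j, ‖x j‖ ^ 2 := by
  have h := Matrix.l2_opNorm_mulVec A (WithLp.toLp 2 x)
  have h2 := pow_le_pow_left₀ (norm_nonneg _) h 2
  rw [mul_pow, EuclideanSpace.norm_sq_eq, EuclideanSpace.norm_sq_eq] at h2
  exact h2

theorem opNorm_le_of_mulVec {A : Matrix I J ℂ} {c : ℝ} (hc : 0 ≤ c)
    (h : ∀ x : J → ℂ, ∑ i, ‖(A *ᵥ x) i‖ ^ 2 ≤ c ^ 2 * ∑ j, ‖x j‖ ^ 2) : opNorm A ≤ c := by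
  change ‖A‖ ≤ c
  rw [Matrix.l2_opNorm_def]
  refine ContinuousLinearMap.opNorm_le_bound _ hc fun x => ?_
  refine le_of_sq_le_sq ?_ (by positivity)
  rw [mul_pow, EuclideanSpace.norm_sq_eq, EuclideanSpace.norm_sq_eq]
  exact h x.ofLp

theorem norm_apply_le_opNorm (A : Matrix I J ℂ) (i : I) (j : J) : ‖A i j‖ ≤ opNorm A := by
  have h := sum_norm_sq_mulVec_le A (Pi.single j 1)
  have h1 : ∑ k, ‖(Pi.single j 1 : J → ℂ) k‖ ^ 2 = 1 := by
    rw [Finset.sum_eq_single j] <;> simp +contextual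
  rw [h1, mul_one] at h
  have h2 : ‖(A *ᵥ Pi.single j 1) i‖ ^ 2 ≤ ∑ i, ‖(A *ᵥ Pi.single j 1) i‖ ^ 2 :=
    Finset.single_le_sum (f := fun i => ‖(A *ᵥ Pi.single j 1) i‖ ^ 2)
      (fun _ _ => by positivity) (Finset.mem_univ i)
  have h3 : (A *ᵥ Pi.single j 1) i = A i j := by simp
  rw [h3] at h2
  exact le_of_sq_le_sq (h2.trans h) (opNorm_nonneg A)

theorem opNorm_fromBlocks_diagonal_le (A : Matrix I J ℂ) (D : Matrix K L ℂ) :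
    opNorm (Matrix.fromBlocks A 0 0 D) ≤ max (opNorm A) (opNorm D) := by
  refine opNorm_le_of_mulVec (le_max_of_le_left (opNorm_nonneg A)) fun x => ?_
  rw [Fintype.sum_sum_type, Fintype.sum_sum_type, mul_add]
  have hA := sum_norm_sq_mulVec_le A (x ∘ Sum.inl)
  have hD := sum_norm_sq_mulVec_le D (x ∘ Sum.inr)
  simp only [Matrix.fromBlocks_mulVec, Sum.elim_inl, Sum.elim_inr, Matrix.zero_mulVec, add_zero,
    zero_add]
  refine add_le_add (hA.trans ?_) (hD.trans ?_)
  · have := pow_le_pow_left₀ (opNorm_nonneg A) (le_max_left (opNorm A) (opNorm D)) 2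
    exact mul_le_mul_of_nonneg_right this (by positivity)
  · have := pow_le_pow_left₀ (opNorm_nonneg D) (le_max_right (opNorm A) (opNorm D)) 2
    exact mul_le_mul_of_nonneg_right this (by positivity)

/-- The C*-identity for the adjoint turns the square into the norm of `A * Aᴴ + B * Bᴴ`. -/
theorem opNorm_fromCols_sq_le (A : Matrix I J ℂ) (B : Matrix I K ℂ) :
    opNorm (Matrix.fromCols A B) ^ 2 ≤ opNorm A ^ 2 + opNorm B ^ 2 := by
  have h := opNorm_mul_self_eq (Matrix.fromCols A B)ᴴ
  rw [opNorm_conjTranspose, Matrix.conjTranspose_conjTranspose,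
    Matrix.conjTranspose_fromCols_eq_fromRows_conjTranspose,
    Matrix.fromCols_mul_fromRows] at h
  have h2 : opNorm (A * Aᴴ + B * Bᴴ) ≤ opNorm (A * Aᴴ) + opNorm (B * Bᴴ) := norm_add_le _ _
  have h3 := opNorm_mul_le A Aᴴ
  have h4 := opNorm_mul_le B Bᴴ
  rw [opNorm_conjTranspose] at h3 h4
  nlinarith

theorem opNorm_column_sq (X : Matrix I (Fin 1) ℂ) : opNorm X ^ 2 = ∑ i, ‖X i 0‖ ^ 2 := by
  apply le_antisymm
  · have h0 : 0 ≤ ∑ i, ‖X i 0‖ ^ 2 := by positivity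
    rw [← Real.sq_sqrt h0]
    refine pow_le_pow_left₀ (opNorm_nonneg X) (opNorm_le_of_mulVec (Real.sqrt_nonneg _) ?_) 2
    intro x
    rw [Real.sq_sqrt h0, Finset.sum_mul]
    refine Finset.sum_le_sum fun i _ => ?_
    simp [Matrix.mulVec, dotProduct, mul_pow]
  · have h := sum_norm_sq_mulVec_le X 1
    simpa [Matrix.mulVec, dotProduct] using h

end OpNormLemmas

/-! ### Two-sided scalar multiplication of matrices over a vector space. -/

section Triple

variable {W W' : Type*} [AddCommGroup W] [Module ℂ W] [AddCommGroup W'] [Module ℂ W']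
variable {I J K L I' J' K' L' : Type*} [Fintype I] [Fintype J] [Fintype K] [Fintype L]
  [Fintype I'] [Fintype J'] [Fintype K'] [Fintype L']

/-- The product `α v β` of a matrix over a vector space with scalar matrices. -/
def triple (α : Matrix I J ℂ) (v : Matrix J K W) (β : Matrix K L ℂ) : Matrix I L W :=
  Matrix.of fun i j => ∑ k, ∑ l, (α i k * β l j) • v k l

theorem sandwich_eq_triple {p q : ℕ} (α : Matrix (Fin p) (Fin q) ℂ)
    (v : Matrix (Fin q) (Fin q) W) (β : Matrix (Fin q) (Fin p) ℂ) :
    sandwich α v β = triple α v β := rfl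

theorem map_triple (f : W →ₗ[ℂ] W') (α : Matrix I J ℂ) (v : Matrix J K W) (β : Matrix K L ℂ) :
    (triple α v β).map f = triple α (v.map f) β := by
  ext i j
  simp [triple]

theorem triple_eq_mul (α : Matrix I J ℂ) (v : Matrix J K ℂ) (β : Matrix K L ℂ) :
    triple α v β = α * v * β := by
  ext i j
  simp only [triple, Matrix.of_apply, Matrix.mul_apply, Finset.sum_mul, smul_eq_mul]
  rw [Finset.sum_comm]
  exact Finset.sum_congr rfl fun _ _ => Finset.sum_congr rfl fun _ _ => by ring

/-- Functionals separate the points of a vector space, so identities for `triple` reduce to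
identities between products of scalar matrices. -/
theorem matrix_ext_dual {A B : Matrix I J W} (h : ∀ f : W →ₗ[ℂ] ℂ, A.map f = B.map f) : A = B := by
  ext i j
  rw [← sub_eq_zero, ← Module.forall_dual_apply_eq_zero_iff ℂ]
  intro f
  have := congrFun (congrFun (h f) i) j
  simpa [sub_eq_zero] using this

theorem triple_triple (α : Matrix I J ℂ) (α' : Matrix J J' ℂ) (v : Matrix J' K' W)
    (β' : Matrix K' K ℂ) (β : Matrix K L ℂ) :
    triple α (triple α' v β') β = triple (α * α') v (β' * β) :=
  matrix_ext_dual fun f => by simp only [map_triple, triple_eq_mul, Matrix.mul_assoc]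

theorem one_triple_one [DecidableEq I] [DecidableEq J] (v : Matrix I J W) :
    triple 1 v 1 = v :=
  matrix_ext_dual fun f => by simp only [map_triple, triple_eq_mul, Matrix.one_mul, Matrix.mul_one]

theorem triple_add (α : Matrix I J ℂ) (v w : Matrix J K W) (β : Matrix K L ℂ) :
    triple α (v + w) β = triple α v β + triple α w β := by
  ext i j
  simp [triple, Finset.sum_add_distrib]

theorem triple_sub (α : Matrix I J ℂ) (v w : Matrix J K W) (β : Matrix K L ℂ) :
    triple α (v - w) β = triple α v β - triple α w β := by
  ext i j
  simp [triple, Finset.sum_sub_distrib, smul_sub]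

theorem triple_zero (α : Matrix I J ℂ) (β : Matrix K L ℂ) :
    triple α (0 : Matrix J K W) β = 0 := by
  ext i j
  simp [triple]

theorem zero_triple (v : Matrix J K W) (β : Matrix K L ℂ) :
    triple (0 : Matrix I J ℂ) v β = 0 := by
  ext i j
  simp [triple]

theorem triple_zero_right (α : Matrix I J ℂ) (v : Matrix J K W) :
    triple α v (0 : Matrix K L ℂ) = 0 := by
  ext i j
  simp [triple]

theorem triple_smul (c : ℂ) (α : Matrix I J ℂ) (v : Matrix J K W) (β : Matrix K L ℂ) :
    triple α (c • v) β = c • triple α v β := by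
  ext i j
  simp [triple, Finset.smul_sum, smul_smul, mul_comm]

theorem smul_triple (c : ℂ) (α : Matrix I J ℂ) (v : Matrix J K W) (β : Matrix K L ℂ) :
    triple (c • α) v β = c • triple α v β := by
  ext i j
  simp [triple, Finset.smul_sum, smul_smul, mul_assoc]

theorem triple_smul_right (c : ℂ) (α : Matrix I J ℂ) (v : Matrix J K W) (β : Matrix K L ℂ) :
    triple α v (c • β) = c • triple α v β := by
  ext i j
  simp [triple, Finset.smul_sum, smul_smul, mul_left_comm]

theorem neg_triple (α : Matrix I J ℂ) (v : Matrix J K W) (β : Matrix K L ℂ) :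
    triple (-α) v β = -triple α v β := by
  simpa using smul_triple (-1) α v β

theorem triple_neg_right (α : Matrix I J ℂ) (v : Matrix J K W) (β : Matrix K L ℂ) :
    triple α v (-β) = -triple α v β := by
  simpa using triple_smul_right (-1) α v β

theorem half_smul_add_self (v : Matrix I J W) : ((1 / 2 : ℝ) : ℂ) • (v + v) = v := by
  rw [← two_smul ℂ v, smul_smul]
  norm_num

theorem conjTranspose_triple [StarAddMonoid W] [StarModule ℂ W]
    (α : Matrix I J ℂ) (v : Matrix J K W) (β : Matrix K L ℂ) :
    (triple α v β)ᴴ = triple βᴴ vᴴ αᴴ := by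
  ext i j
  simp only [triple, Matrix.conjTranspose_apply, Matrix.of_apply, star_sum, star_smul, star_mul']
  rw [Finset.sum_comm]
  exact Finset.sum_congr rfl fun _ _ => Finset.sum_congr rfl fun _ _ => by rw [mul_comm]

theorem triple_fromBlocks (A : Matrix I J ℂ) (D : Matrix I' J' ℂ)
    (u : Matrix J K W) (z : Matrix J K' W) (z' : Matrix J' K W) (u' : Matrix J' K' W)
    (A' : Matrix K L ℂ) (D' : Matrix K' L' ℂ) :
    triple (Matrix.fromBlocks A 0 0 D) (Matrix.fromBlocks u z z' u')
        (Matrix.fromBlocks A' 0 0 D') =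
      Matrix.fromBlocks (triple A u A') (triple A z D') (triple D z' A') (triple D u' D') :=
  matrix_ext_dual fun f => by
    simp [map_triple, triple_eq_mul, Matrix.fromBlocks_map, Matrix.fromBlocks_multiply]

theorem fromCols_triple_fromRows (s : Matrix I J ℂ) (t : Matrix I J' ℂ)
    (u : Matrix J K W) (z : Matrix J K' W) (z' : Matrix J' K W) (u' : Matrix J' K' W)
    (s' : Matrix K L ℂ) (t' : Matrix K' L ℂ) :
    triple (Matrix.fromCols s t) (Matrix.fromBlocks u z z' u') (Matrix.fromRows s' t') =
      triple s u s' + triple t z' s' + (triple s z t' + triple t u' t') :=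
  matrix_ext_dual fun f => by
    rw [Matrix.map_add _ (map_add f), Matrix.map_add _ (map_add f), Matrix.map_add _ (map_add f)]
    simp only [map_triple, triple_eq_mul, Matrix.fromBlocks_map, Matrix.fromCols_mul_fromBlocks,
      Matrix.fromCols_mul_fromRows, Matrix.add_mul]

theorem fromRows_triple_fromCols (s : Matrix I J ℂ) (t : Matrix I' J ℂ)
    (u : Matrix J K W) (s' : Matrix K L ℂ) (t' : Matrix K L' ℂ) :
    triple (Matrix.fromRows s t) u (Matrix.fromCols s' t') =
      Matrix.fromBlocks (triple s u s') (triple s u t') (triple t u s') (triple t u t') :=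
  matrix_ext_dual fun f => by
    simp [map_triple, triple_eq_mul, Matrix.fromBlocks_map, Matrix.fromRows_mul]

/-- The matrix of `submatrix`: rows and columns of `v` are selected by `e`. -/
def selMat [DecidableEq J] (e : I → J) : Matrix I J ℂ := Matrix.of fun i j => if e i = j then 1 else 0

theorem selMat_triple [DecidableEq J] [DecidableEq K] (e : I → J) (e' : L → K) (v : Matrix J K W) :
    triple (selMat e) v (selMat e')ᴴ = v.submatrix e e' := by
  ext i j
  simp only [triple, selMat, Matrix.conjTranspose_apply, Matrix.of_apply, Matrix.submatrix_apply]
  rw [Finset.sum_eq_single (e i), Finset.sum_eq_single (e' j)] <;> simp +contextual [eq_comm]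

theorem opNorm_selMat_le [DecidableEq I] [DecidableEq J] {e : I → J} (he : Function.Injective e) :
    opNorm (selMat e) ≤ 1 := by
  refine opNorm_le_one_of_mul_conjTranspose_self ?_
  ext i j
  simp [Matrix.mul_apply, selMat, Matrix.one_apply, he.eq_iff, eq_comm]

end Triple

/-! ### Norm properties that follow from compression and direct sums. -/

section RuanFamily

variable {W : Type*} [AddCommGroup W] [Module ℂ W]

/-- A family of gauges on matrices over `W`, indexed by arbitrary finite types, that is
compatible with multiplication by scalar matrices and with direct sums. -/
structure RuanFamily
    (M : ∀ (I : Type) [Fintype I] [DecidableEq I], Matrix I I W → ℝ) : Prop where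
  nonneg : ∀ (I : Type) [Fintype I] [DecidableEq I] (u : Matrix I I W), 0 ≤ M I u
  triple_le : ∀ (I J : Type) [Fintype I] [DecidableEq I] [Fintype J] [DecidableEq J]
    (α : Matrix I J ℂ) (u : Matrix J J W) (β : Matrix J I ℂ),
    M I (triple α u β) ≤ opNorm α * M J u * opNorm β
  sum_le : ∀ (I J : Type) [Fintype I] [DecidableEq I] [Fintype J] [DecidableEq J]
    (u : Matrix I I W) (v : Matrix J J W),
    M (I ⊕ J) (Matrix.fromBlocks u 0 0 v) ≤ max (M I u) (M J v)

namespace RuanFamily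

variable {M : ∀ (I : Type) [Fintype I] [DecidableEq I], Matrix I I W → ℝ} (hM : RuanFamily M)
variable {I J : Type} [Fintype I] [DecidableEq I] [Fintype J] [DecidableEq J]
include hM

theorem smul_le (c : ℂ) (u : Matrix I I W) : M I (c • u) ≤ ‖c‖ * M I u := by
  have h := hM.triple_le I I (c • 1) u 1
  rw [smul_triple, one_triple_one, opNorm_smul] at h
  have h1 := opNorm_one_le (I := I)
  have h2 := hM.nonneg I u
  have h3 := opNorm_nonneg (1 : Matrix I I ℂ)
  calc M I (c • u) ≤ _ := h
    _ ≤ ‖c‖ * 1 * M I u * 1 := by gcongr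
    _ = _ := by ring

theorem zero : M I 0 = 0 := by
  have h := hM.smul_le (0 : ℂ) (0 : Matrix I I W)
  rw [zero_smul, norm_zero, zero_mul] at h
  exact le_antisymm h (hM.nonneg I 0)

theorem smul_eq (c : ℂ) (u : Matrix I I W) : M I (c • u) = ‖c‖ * M I u := by
  refine le_antisymm (hM.smul_le c u) ?_
  rcases eq_or_ne c 0 with rfl | hc
  · simp [hM.zero]
  · have h := hM.smul_le c⁻¹ (c • u)
    rw [smul_smul, inv_mul_cancel₀ hc, one_smul, norm_inv] at h
    have hc' : 0 < ‖c‖ := norm_pos_iff.2 hc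
    calc ‖c‖ * M I u ≤ ‖c‖ * (‖c‖⁻¹ * M I (c • u)) := by gcongr
      _ = _ := by field_simp

theorem neg_eq (u : Matrix I I W) : M I (-u) = M I u := by
  have h := hM.smul_eq (-1) u
  simpa using h

theorem submatrix_le {e : I → J} (he : Function.Injective e) (u : Matrix J J W) :
    M I (u.submatrix e e) ≤ M J u := by
  have h := hM.triple_le I J (selMat e) u (selMat e)ᴴ
  rw [selMat_triple, opNorm_conjTranspose] at h
  have h1 := opNorm_selMat_le he
  have h2 := hM.nonneg J u
  have h3 := opNorm_nonneg (selMat e)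
  calc _ ≤ _ := h
    _ ≤ 1 * M J u * 1 := by gcongr
    _ = _ := by ring

theorem reindex_eq (e : I ≃ J) (u : Matrix I I W) : M J (Matrix.reindex e e u) = M I u := by
  refine le_antisymm (hM.submatrix_le e.symm.injective u) ?_
  have h := hM.submatrix_le e.injective (Matrix.reindex e e u)
  simpa using h

theorem sum_eq (u : Matrix I I W) (v : Matrix J J W) :
    M (I ⊕ J) (Matrix.fromBlocks u 0 0 v) = max (M I u) (M J v) := by
  refine le_antisymm (hM.sum_le I J u v) (max_le ?_ ?_)
  · exact hM.submatrix_le (e := (Sum.inl : I → I ⊕ J)) Sum.inl_injective (Matrix.fromBlocks u 0 0 v)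
  · exact hM.submatrix_le (e := (Sum.inr : J → I ⊕ J)) Sum.inr_injective (Matrix.fromBlocks u 0 0 v)

/-- Write `u + v = R (a⁻¹u ⊕ b⁻¹v) R*` with the row `R = (√a·1 √b·1)`. The middle factor has gauge
at most `1`, and `‖R‖² ≤ a + b`. -/
theorem add_le_of_lt {u v : Matrix I I W} {a b : ℝ} (ha : M I u < a) (hb : M I v < b) :
    M I (u + v) ≤ a + b := by
  have ha0 : 0 < a := (hM.nonneg I u).trans_lt ha
  have hb0 : 0 < b := (hM.nonneg I v).trans_lt hb
  set R : Matrix I (I ⊕ I) ℂ :=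
    Matrix.fromCols ((Real.sqrt a : ℂ) • 1) ((Real.sqrt b : ℂ) • 1) with hR
  have key : u + v = triple R
      (Matrix.fromBlocks ((a⁻¹ : ℂ) • u) 0 0 ((b⁻¹ : ℂ) • v)) Rᴴ := by
    have hsa : (Real.sqrt a : ℂ) * Real.sqrt a = a := by
      rw [← Complex.ofReal_mul, Real.mul_self_sqrt ha0.le]
    have hsb : (Real.sqrt b : ℂ) * Real.sqrt b = b := by
      rw [← Complex.ofReal_mul, Real.mul_self_sqrt hb0.le]
    have ha' : (a : ℂ) ≠ 0 := by exact_mod_cast ha0.ne'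
    have hb' : (b : ℂ) ≠ 0 := by exact_mod_cast hb0.ne'
    rw [hR, Matrix.conjTranspose_fromCols_eq_fromRows_conjTranspose, fromCols_triple_fromRows]
    simp only [Matrix.conjTranspose_smul, Matrix.conjTranspose_one, smul_triple,
      triple_smul_right, one_triple_one, triple_zero, smul_smul, smul_zero]
    simp only [Complex.star_def, Complex.conj_ofReal, add_zero, zero_add, ← mul_assoc, hsa, hsb,
      mul_inv_cancel₀ ha', mul_inv_cancel₀ hb', one_smul]
  have hRn : opNorm R ^ 2 ≤ a + b := by
    refine (opNorm_fromCols_sq_le _ _).trans ?_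
    have h1 := opNorm_one_le (I := I)
    have h0 := opNorm_nonneg (1 : Matrix I I ℂ)
    have h2 : opNorm (1 : Matrix I I ℂ) ^ 2 ≤ 1 := pow_le_one₀ h0 h1
    rw [opNorm_smul, opNorm_smul, mul_pow, mul_pow, Complex.norm_real, Complex.norm_real,
      Real.norm_of_nonneg (Real.sqrt_nonneg _), Real.norm_of_nonneg (Real.sqrt_nonneg _),
      Real.sq_sqrt ha0.le, Real.sq_sqrt hb0.le]
    nlinarith
  have hB : M (I ⊕ I) (Matrix.fromBlocks ((a⁻¹ : ℂ) • u) 0 0 ((b⁻¹ : ℂ) • v)) ≤ 1 := by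
    refine (hM.sum_le I I _ _).trans (max_le ?_ ?_)
    · rw [hM.smul_eq, norm_inv, Complex.norm_real, Real.norm_of_nonneg ha0.le,
        inv_mul_le_iff₀ ha0]
      linarith
    · rw [hM.smul_eq, norm_inv, Complex.norm_real, Real.norm_of_nonneg hb0.le,
        inv_mul_le_iff₀ hb0]
      linarith
  rw [key]
  have h := hM.triple_le I (I ⊕ I) R
    (Matrix.fromBlocks ((a⁻¹ : ℂ) • u) 0 0 ((b⁻¹ : ℂ) • v)) Rᴴ
  rw [opNorm_conjTranspose] at h
  have h0 := opNorm_nonneg R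
  calc _ ≤ _ := h
    _ ≤ opNorm R * 1 * opNorm R := by gcongr
    _ = opNorm R ^ 2 := by ring
    _ ≤ _ := hRn

theorem add_le (u v : Matrix I I W) : M I (u + v) ≤ M I u + M I v := by
  refine le_of_forall_pos_le_add fun ε hε => ?_
  have h := hM.add_le_of_lt (u := u) (v := v) (a := M I u + ε / 2) (b := M I v + ε / 2)
    (by linarith) (by linarith)
  linarith

theorem sub_le (u v : Matrix I I W) : M I (u - v) ≤ M I u + M I v := by
  rw [sub_eq_add_neg, ← hM.neg_eq v]
  exact hM.add_le u (-v)

end RuanFamily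

end RuanFamily

end

section

open scoped Matrix

/-! ### Block matrices and matrix units with shifted indices. -/

section BlockMat

variable {W : Type*} [AddCommGroup W] [Module ℂ W] {p q : ℕ}
  (A : Matrix (Fin p) (Fin p) W) (B : Matrix (Fin p) (Fin q) W)
  (C : Matrix (Fin q) (Fin p) W) (D : Matrix (Fin q) (Fin q) W)

@[simp] theorem blockMat_castAdd_castAdd (i j : Fin p) :
    blockMat A B C D (Fin.castAdd q i) (Fin.castAdd q j) = A i j := by simp [blockMat]

@[simp] theorem blockMat_castAdd_natAdd (i : Fin p) (j : Fin q) :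
    blockMat A B C D (Fin.castAdd q i) (Fin.natAdd p j) = B i j := by simp [blockMat]

@[simp] theorem blockMat_natAdd_castAdd (i : Fin q) (j : Fin p) :
    blockMat A B C D (Fin.natAdd p i) (Fin.castAdd q j) = C i j := by simp [blockMat]

@[simp] theorem blockMat_natAdd_natAdd (i j : Fin q) :
    blockMat A B C D (Fin.natAdd p i) (Fin.natAdd p j) = D i j := by simp [blockMat]

theorem exists_eq_castAdd {r s : ℕ} {i : Fin (r + s)} (h : (i : ℕ) < r) :
    ∃ i', i = Fin.castAdd s i' := ⟨⟨i, h⟩, rfl⟩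

theorem exists_eq_natAdd {r s : ℕ} {i : Fin (r + s)} (h : ¬ (i : ℕ) < r) :
    ∃ i', i = Fin.natAdd r i' :=
  ⟨⟨i - r, by omega⟩, Fin.ext (by simp only [Fin.val_natAdd]; omega)⟩

theorem conjTranspose_blockMat [StarAddMonoid W] :
    (blockMat A B C D)ᴴ = blockMat Aᴴ Cᴴ Bᴴ Dᴴ := by
  rw [blockMat, blockMat, Matrix.conjTranspose_reindex, Matrix.fromBlocks_conjTranspose]

end BlockMat

section Eps

theorem eps_succ_succ {k : ℕ} (i j : Fin k) :
    eps k ((i : ℤ) + 1) ((j : ℤ) + 1) = Matrix.single i j 1 := by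
  ext a b
  simp [eps, Matrix.single_apply, Fin.ext_iff, eq_comm]

theorem eps_eq_zero_left {k : ℕ} {i : ℤ} (j : ℤ) (h : i ∉ Set.Icc (1 : ℤ) k) : eps k i j = 0 := by
  ext a b
  have : ¬ ((a : ℤ) + 1 = i ∧ (b : ℤ) + 1 = j) := by
    rintro ⟨h1, -⟩
    exact h ⟨by omega, by omega⟩
  simp [eps, this]

theorem eps_eq_zero_right {k : ℕ} (i : ℤ) {j : ℤ} (h : j ∉ Set.Icc (1 : ℤ) k) : eps k i j = 0 := by
  ext a b
  have : ¬ ((a : ℤ) + 1 = i ∧ (b : ℤ) + 1 = j) := by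
    rintro ⟨-, h1⟩
    exact h ⟨by omega, by omega⟩
  simp [eps, this]

end Eps

/-! ### Amplified matrix products: expansion in matrix units and sign averaging. -/

section Amplify

variable {m k q : ℕ} {V : Fin m → Type*} {W : Type*} [∀ t, AddCommGroup (V t)]
  [∀ t, Module ℂ (V t)] [AddCommGroup W] [Module ℂ W]
  (lam : MultilinearMap ℂ (fun _ : Fin m => Matrix (Fin k) (Fin k) ℂ) (Matrix (Fin q) (Fin q) ℂ))
  (φ : MultilinearMap ℂ V W)

theorem map_amplify (v : ∀ t, Matrix (Fin k) (Fin k) (V t)) (f : W →ₗ[ℂ] ℂ) :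
    (amplify lam φ v).map f = ∑ i : Fin m → Fin k, ∑ j : Fin m → Fin k,
      f (φ fun t => v t (i t) (j t)) • lam (fun t => Matrix.single (i t) (j t) (1 : ℂ)) := by
  ext a b
  simp [amplify, Matrix.sum_apply, mul_comm]

theorem triple_amplify {I J : Type*} [Fintype I] [Fintype J] (α : Matrix I (Fin q) ℂ)
    (v : ∀ t, Matrix (Fin k) (Fin k) (V t)) (β : Matrix (Fin q) J ℂ) :
    triple α (amplify lam φ v) β = Matrix.of fun a b =>
      ∑ i : Fin m → Fin k, ∑ j : Fin m → Fin k,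
        (α * lam (fun t => Matrix.single (i t) (j t) (1 : ℂ)) * β) a b •
          φ (fun t => v t (i t) (j t)) := by
  refine matrix_ext_dual fun f => ?_
  rw [map_triple, map_amplify, triple_eq_mul]
  simp only [Matrix.mul_sum, Matrix.sum_mul, Matrix.mul_smul, Matrix.smul_mul]
  ext a b
  simp [Matrix.sum_apply, mul_comm]

theorem amplify_smul (c : Fin m → ℂ) (v : ∀ t, Matrix (Fin k) (Fin k) (V t)) :
    amplify lam φ (fun t => c t • v t) = (∏ t, c t) • amplify lam φ v := by
  ext a b
  simp only [amplify, Matrix.of_apply, Matrix.smul_apply, MultilinearMap.map_smul_univ,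
    Finset.smul_sum]
  exact Finset.sum_congr rfl fun _ _ => Finset.sum_congr rfl fun _ _ => smul_comm _ _ _

theorem amplify_eq_zero {v : ∀ t, Matrix (Fin k) (Fin k) (V t)} {t : Fin m} (h : v t = 0) :
    amplify lam φ v = 0 := by
  ext a b
  simp only [amplify, Matrix.of_apply, Matrix.zero_apply]
  refine Finset.sum_eq_zero fun i _ => Finset.sum_eq_zero fun j _ => ?_
  rw [φ.map_coord_zero t (by rw [h]; rfl), smul_zero]

theorem sum_prod_smul_eq (x : Fin m → Matrix (Fin k) (Fin k) ℂ) :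
    ∑ i : Fin m → Fin k, ∑ j : Fin m → Fin k,
      (∏ t, x t (i t) (j t)) • lam (fun t => Matrix.single (i t) (j t) (1 : ℂ)) = lam x := by
  have hx : x = fun t => ∑ p : Fin k × Fin k, x t p.1 p.2 • Matrix.single p.1 p.2 (1 : ℂ) := by
    funext t
    rw [Fintype.sum_prod_type]
    conv_lhs => rw [Matrix.matrix_eq_sum_single (x t)]
    simp
  conv_rhs => rw [hx, MultilinearMap.map_sum]
  rw [← Fintype.sum_prod_type'
    (f := fun (i j : Fin m → Fin k) => (∏ t, x t (i t) (j t)) •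
      lam (fun t => Matrix.single (i t) (j t) (1 : ℂ)))]
  refine Fintype.sum_equiv (Equiv.arrowProdEquivProdArrow _ (fun _ => Fin k) (fun _ => Fin k)).symm _ _ fun p => ?_
  rw [MultilinearMap.map_smul_univ]
  rfl

theorem amplify_smul_apply (A : Fin m → Matrix (Fin k) (Fin k) ℂ) (w : ∀ t, V t) :
    amplify lam φ (fun t => Matrix.of fun a b => A t a b • w t) =
      Matrix.of fun a b => lam A a b • φ w := by
  ext a b
  simp only [amplify, Matrix.of_apply, MultilinearMap.map_smul_univ]
  rw [← sum_prod_smul_eq lam A, Matrix.sum_apply, Finset.sum_smul]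
  refine Finset.sum_congr rfl fun i _ => ?_
  rw [Matrix.sum_apply, Finset.sum_smul]
  refine Finset.sum_congr rfl fun j _ => ?_
  rw [Matrix.smul_apply, smul_smul, smul_eq_mul, mul_comm]

/-- Discards the multi-indices outside the chosen block, on which the summand vanishes. -/
theorem sum_sum_of_injective {n r : ℕ} {e e' : Fin r → Fin n} (he : Function.Injective e)
    (he' : Function.Injective e') (F : (Fin m → Fin n) → (Fin m → Fin n) → W)
    (h : ∀ i j, (∃ t, i t ∉ Set.range e ∨ j t ∉ Set.range e') → F i j = 0) :
    ∑ i, ∑ j, F i j = ∑ i : Fin m → Fin r, ∑ j : Fin m → Fin r, F (e ∘ i) (e' ∘ j) := by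
  symm
  have hr : ∀ {e : Fin r → Fin n} {i : Fin m → Fin n}, i ∉ Set.range (fun k => e ∘ k) →
      ∃ t, i t ∉ Set.range e := by
    intro e i hi
    by_contra! hc
    choose g hg using hc
    exact hi ⟨g, funext hg⟩
  refine Fintype.sum_of_injective (fun i => e ∘ i) he.comp_left _ _ ?_ ?_
  · intro i hi
    obtain ⟨t, ht⟩ := hr hi
    exact Finset.sum_eq_zero fun j _ => h i j ⟨t, Or.inl ht⟩
  · intro i
    refine Fintype.sum_of_injective (fun i => e' ∘ i) he'.comp_left _ _ ?_ fun _ => rfl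
    intro j hj
    obtain ⟨t, ht⟩ := hr hj
    exact h _ j ⟨t, Or.inr ht⟩

/-- Here `g` is the index counted from `1` after shifting a block to the origin, and `e` embeds that
block. The convention that `eps` vanishes out of range makes the sum see only the block. -/
theorem sum_eps_smul {n : ℕ} {e e' : Fin k → Fin n} {g g' : Fin n → ℤ}
    (he : ∀ i, g (e i) = i + 1) (he' : ∀ i, g' (e' i) = i + 1)
    (hg : ∀ i, g i ∈ Set.Icc (1 : ℤ) k → i ∈ Set.range e)
    (hg' : ∀ i, g' i ∈ Set.Icc (1 : ℤ) k → i ∈ Set.range e')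
    (x : ∀ t, Matrix (Fin n) (Fin n) (V t)) (a b : Fin q) :
    ∑ i : Fin m → Fin n, ∑ j : Fin m → Fin n,
      lam (fun t => eps k (g (i t)) (g' (j t))) a b • φ (fun t => x t (i t) (j t)) =
    amplify lam φ (fun t => (x t).submatrix e e') a b := by
  have hinj : ∀ {e : Fin k → Fin n} {g : Fin n → ℤ}, (∀ i, g (e i) = i + 1) →
      Function.Injective e := by
    intro e g h i j hij
    have h1 := h i
    rw [hij, h j] at h1
    exact Fin.ext (by omega)
  rw [sum_sum_of_injective (hinj he) (hinj he')]
  · simp [amplify, he, he', eps_succ_succ]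
  · rintro i j ⟨t, ht⟩
    rw [lam.map_coord_zero t, Matrix.zero_apply, zero_smul]
    rcases ht with ht | ht
    · exact eps_eq_zero_left _ fun hc => ht (hg _ hc)
    · exact eps_eq_zero_right _ fun hc => ht (hg' _ hc)

/-- The sum over signs factors over `t`. From the summand `1` the factor is `2` if `d t` holds and
`0` otherwise; from the summand `∏ s_t` the roles are reversed, as `s_t² = 1`. Mixed patterns
contribute `0` to both. -/
theorem sum_units_prod (d : Fin m → Prop) [DecidablePred d] :
    ∑ s : Fin m → ℤˣ, (1 + ∏ t, ((s t : ℤ) : ℂ)) * ∏ t, (if d t then 1 else ((s t : ℤ) : ℂ)) =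
      2 ^ m * (∏ t, (if d t then 1 else 0) + ∏ t, (if d t then 0 else 1)) := by
  have hu : ∀ F : ℤˣ → ℂ, ∑ s, F s = F 1 + F (-1) := by
    intro F
    rw [show (Finset.univ : Finset ℤˣ) = {1, -1} from rfl, Finset.sum_pair (by decide)]
  have h2 : (2 : ℂ) ^ m = ∏ _t : Fin m, 2 := by simp
  simp only [add_mul, one_mul, Finset.sum_add_distrib, ← Finset.prod_mul_distrib, mul_add]
  have key : ∀ G : Fin m → ℤˣ → ℂ, ∑ s : Fin m → ℤˣ, ∏ t, G t (s t) = ∏ t, ∑ x, G t x := by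
    intro G
    rw [Finset.prod_univ_sum, Fintype.piFinset_univ]
  rw [key (fun t s => if d t then 1 else ((s : ℤ) : ℂ)),
    key (fun t s => ((s : ℤ) : ℂ) * if d t then 1 else ((s : ℤ) : ℂ))]
  simp only [hu, h2, ← Finset.prod_mul_distrib]
  congr 1 <;> refine Finset.prod_congr rfl fun t _ => ?_ <;> by_cases h : d t <;> simp [h] <;>
    norm_num

theorem sum_units_amplify (d : Fin k → Fin k → Prop) [DecidableRel d]
    (x : ∀ t, Matrix (Fin k) (Fin k) (V t)) :
    ∑ s : Fin m → ℤˣ, (1 + ∏ t, ((s t : ℤ) : ℂ)) • amplify lam φ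
        (fun t => Matrix.of fun i j => (if d i j then 1 else ((s t : ℤ) : ℂ)) • x t i j) =
      (2 ^ m : ℂ) • (amplify lam φ (fun t => Matrix.of fun i j => if d i j then x t i j else 0) +
        amplify lam φ (fun t => Matrix.of fun i j => if d i j then 0 else x t i j)) := by
  have h1 : ∀ t i j, (if d i j then x t i j else 0) = (if d i j then (1 : ℂ) else 0) • x t i j := by
    intro t i j; split_ifs <;> simp
  have h2 : ∀ t i j, (if d i j then 0 else x t i j) = (if d i j then (0 : ℂ) else 1) • x t i j := by
    intro t i j; split_ifs <;> simp
  ext a b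
  simp only [h1, h2, amplify, Matrix.sum_apply, Matrix.smul_apply, Matrix.add_apply,
    Matrix.of_apply, MultilinearMap.map_smul_univ, Finset.smul_sum, ← Finset.sum_add_distrib]
  rw [Finset.sum_comm]
  refine Finset.sum_congr rfl fun i _ => ?_
  rw [Finset.sum_comm]
  refine Finset.sum_congr rfl fun j _ => ?_
  have key := sum_units_prod (fun t => d (i t) (j t))
  rw [← smul_add, ← add_smul, smul_comm ((2 : ℂ) ^ m), smul_smul ((2 : ℂ) ^ m), ← key, Finset.sum_smul,
    Finset.smul_sum]
  refine Finset.sum_congr rfl fun s _ => ?_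
  rw [smul_comm]
  congr 1
  rw [smul_smul]

end Amplify

/-! ### Consequences of (E2), (O1) and (O2) for tensors of block matrices. -/

namespace MatrixProducts

variable {m : ℕ} (L : MatrixProducts m)
variable {V : Fin m → Type*} [∀ t, AddCommGroup (V t)] [∀ t, Module ℂ (V t)]

theorem tensor_smul (j : ℕ) (c : Fin m → ℂ) (v : ∀ t, Matrix (Fin j) (Fin j) (V t)) :
    L.tensor j (fun t => c t • v t) = (∏ t, c t) • L.tensor j v := amplify_smul _ _ c v

theorem conjTranspose_tensor [∀ t, StarAddMonoid (V t)] [∀ t, StarModule ℂ (V t)]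
    (hO1 : L.O1) {j : ℕ} (hj : 0 < j) (v : ∀ t, Matrix (Fin j) (Fin j) (V t)) :
    (L.tensor j v)ᴴ = L.tensor j (fun t => (v t)ᴴ) := by
  ext a b
  simp only [tensor, amplify, Matrix.conjTranspose_apply, Matrix.of_apply, star_sum, star_smul,
    star_tprod]
  rw [Finset.sum_comm]
  refine Finset.sum_congr rfl fun i _ => Finset.sum_congr rfl fun i' _ => ?_
  congr 1
  rw [hO1 j hj i i']
  simp

variable {L}

/-- The identity for `P` says nothing about tuples having some `(i_t, j_t)` in an off-diagonal
block, but there the entry of the `t`-th block matrix is `0`, so the elementary tensor vanishes. -/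
theorem triple_tensor_diagonal {r s : ℕ}
    {P : Matrix (Fin (L.τ r) ⊕ Fin (L.τ s)) (Fin (L.τ (r + s))) ℂ} (hP : L.DiagIdentity r s P)
    (v : ∀ t, Matrix (Fin r) (Fin r) (V t)) (w : ∀ t, Matrix (Fin s) (Fin s) (V t)) :
    triple P (L.tensor (r + s) fun t => blockMat (v t) 0 0 (w t)) Pᴴ =
      Matrix.fromBlocks (L.tensor r v) 0 0 (L.tensor s w) := by
  rw [tensor, triple_amplify]
  have key : ∀ (i j : Fin m → Fin (r + s)) a b,
      (P * L.prod (r + s) (fun t => Matrix.single (i t) (j t) (1 : ℂ)) * Pᴴ) a b •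
        PiTensorProduct.tprod ℂ (fun t => blockMat (v t) 0 0 (w t) (i t) (j t)) =
      (Matrix.fromBlocks (L.prod r fun t => eps r ((i t : ℤ) + 1) ((j t : ℤ) + 1)) 0 0
        (L.prod s fun t => eps s ((i t : ℤ) + 1 - r) ((j t : ℤ) + 1 - r))) a b •
        PiTensorProduct.tprod ℂ (fun t => blockMat (v t) 0 0 (w t) (i t) (j t)) := by
    intro i j a b
    by_cases h : ∀ t, ((i t : ℕ) < r ↔ (j t : ℕ) < r)
    · rw [← hP]
      · simp only [← eps_succ_succ]
      · intro t
        have := h t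
        have h1 := (i t).2
        have h2 := (j t).2
        simp only [Set.mem_Icc]
        omega
    · push Not at h
      obtain ⟨t, ht⟩ := h
      rw [(PiTensorProduct.tprod ℂ).map_coord_zero t, smul_zero, smul_zero]
      rcases ht with ⟨h1, h2⟩ | ⟨h1, h2⟩
      · obtain ⟨i', hi'⟩ := exists_eq_castAdd h1
        obtain ⟨j', hj'⟩ := exists_eq_natAdd (i := j t) (by omega)
        rw [hi', hj', blockMat_castAdd_natAdd, Matrix.zero_apply]
      · obtain ⟨i', hi'⟩ := exists_eq_natAdd (i := i t) (by omega)
        obtain ⟨j', hj'⟩ := exists_eq_castAdd h2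
        rw [hi', hj', blockMat_natAdd_castAdd, Matrix.zero_apply]
  have hl : ∀ i : Fin (r + s), (i : ℤ) + 1 ∈ Set.Icc (1 : ℤ) r → i ∈ Set.range (Fin.castAdd s) := by
    intro i hi
    obtain ⟨i', h⟩ := exists_eq_castAdd (i := i) (by have := hi.2; omega)
    exact ⟨i', h.symm⟩
  have hr : ∀ i : Fin (r + s), (i : ℤ) + 1 - r ∈ Set.Icc (1 : ℤ) s →
      i ∈ Set.range (Fin.natAdd r) := by
    intro i hi
    obtain ⟨i', h⟩ := exists_eq_natAdd (i := i) (by have := hi.1; omega)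
    exact ⟨i', h.symm⟩
  have hvl : ∀ t, (blockMat (v t) 0 0 (w t)).submatrix (Fin.castAdd s) (Fin.castAdd s) = v t := by
    intro t; ext i j; simp
  have hwr : ∀ t, (blockMat (v t) 0 0 (w t)).submatrix (Fin.natAdd r) (Fin.natAdd r) = w t := by
    intro t; ext i j; simp
  ext a b
  simp only [Matrix.of_apply, key]
  rcases a with a | a <;> rcases b with b | b
  · simp only [Matrix.fromBlocks_apply₁₁]
    rw [sum_eps_smul (L.prod r) (PiTensorProduct.tprod ℂ) (g := fun i => (i : ℤ) + 1)
      (g' := fun i => (i : ℤ) + 1) (e := Fin.castAdd s) (e' := Fin.castAdd s)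
      (by simp) (by simp) hl hl]
    simp only [hvl, tensor]
  · simp
  · simp
  · simp only [Matrix.fromBlocks_apply₂₂]
    rw [sum_eps_smul (L.prod s) (PiTensorProduct.tprod ℂ) (g := fun i => (i : ℤ) + 1 - r)
      (g' := fun i => (i : ℤ) + 1 - r) (e := Fin.natAdd r) (e' := Fin.natAdd r)
      (by intro i; push_cast [Fin.val_natAdd]; ring) (by intro i; push_cast [Fin.val_natAdd]; ring) hr hr]
    simp only [hwr, tensor]

/-- Tuples not covered by the identity for `P` meet a zero diagonal block in some factor, and so
drop out. -/
theorem triple_tensor_antidiagonal {r : ℕ}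
    {P : Matrix (Fin (L.τ r) ⊕ Fin (L.τ r)) (Fin (L.τ (r + r))) ℂ} (hP : L.AntidiagIdentity r P)
    (v w : ∀ t, Matrix (Fin r) (Fin r) (V t)) :
    triple P (L.tensor (r + r) fun t => blockMat 0 (v t) (w t) 0) Pᴴ =
      Matrix.fromBlocks 0 (L.tensor r v) (L.tensor r w) 0 := by
  rw [tensor, triple_amplify]
  have key : ∀ (i j : Fin m → Fin (r + r)) a b,
      (P * L.prod (r + r) (fun t => Matrix.single (i t) (j t) (1 : ℂ)) * Pᴴ) a b •
        PiTensorProduct.tprod ℂ (fun t => blockMat 0 (v t) (w t) 0 (i t) (j t)) =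
      (Matrix.fromBlocks 0 (L.prod r fun t => eps r ((i t : ℤ) + 1) ((j t : ℤ) + 1 - r))
        (L.prod r fun t => eps r ((i t : ℤ) + 1 - r) ((j t : ℤ) + 1)) 0) a b •
        PiTensorProduct.tprod ℂ (fun t => blockMat 0 (v t) (w t) 0 (i t) (j t)) := by
    intro i j a b
    by_cases h : ∀ t, ((i t : ℕ) < r ↔ ¬ (j t : ℕ) < r)
    · rw [← hP]
      · simp only [← eps_succ_succ]
      · intro t
        have := h t
        have h1 := (i t).2
        have h2 := (j t).2
        simp only [Set.mem_Icc]
        omega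
    · push Not at h
      obtain ⟨t, ht⟩ := h
      rw [(PiTensorProduct.tprod ℂ).map_coord_zero t, smul_zero, smul_zero]
      rcases ht with ⟨h1, h2⟩ | ⟨h1, h2⟩
      · obtain ⟨i', hi'⟩ := exists_eq_castAdd h1
        obtain ⟨j', hj'⟩ := exists_eq_castAdd (i := j t) (by omega)
        rw [hi', hj', blockMat_castAdd_castAdd, Matrix.zero_apply]
      · obtain ⟨i', hi'⟩ := exists_eq_natAdd (i := i t) (by omega)
        obtain ⟨j', hj'⟩ := exists_eq_natAdd (i := j t) (by omega)
        rw [hi', hj', blockMat_natAdd_natAdd, Matrix.zero_apply]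
  have hl : ∀ i : Fin (r + r), (i : ℤ) + 1 ∈ Set.Icc (1 : ℤ) r → i ∈ Set.range (Fin.castAdd r) := by
    intro i hi
    obtain ⟨i', h⟩ := exists_eq_castAdd (i := i) (by have := hi.2; omega)
    exact ⟨i', h.symm⟩
  have hr : ∀ i : Fin (r + r), (i : ℤ) + 1 - r ∈ Set.Icc (1 : ℤ) r →
      i ∈ Set.range (Fin.natAdd r) := by
    intro i hi
    obtain ⟨i', h⟩ := exists_eq_natAdd (i := i) (by have := hi.1; omega)
    exact ⟨i', h.symm⟩
  have hv : ∀ t, (blockMat 0 (v t) (w t) 0).submatrix (Fin.castAdd r) (Fin.natAdd r) = v t := by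
    intro t; ext i j; simp only [Matrix.submatrix_apply, blockMat_castAdd_natAdd]
  have hw : ∀ t, (blockMat 0 (v t) (w t) 0).submatrix (Fin.natAdd r) (Fin.castAdd r) = w t := by
    intro t; ext i j; simp only [Matrix.submatrix_apply, blockMat_natAdd_castAdd]
  ext a b
  simp only [Matrix.of_apply, key]
  rcases a with a | a <;> rcases b with b | b
  · simp
  · simp only [Matrix.fromBlocks_apply₁₂]
    rw [sum_eps_smul (L.prod r) (PiTensorProduct.tprod ℂ) (g := fun i => (i : ℤ) + 1)
      (g' := fun i => (i : ℤ) + 1 - r) (e := Fin.castAdd r) (e' := Fin.natAdd r)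
      (by simp) (by intro i; push_cast [Fin.val_natAdd]; ring) hl hr]
    simp only [hv, tensor]
  · simp only [Matrix.fromBlocks_apply₂₁]
    rw [sum_eps_smul (L.prod r) (PiTensorProduct.tprod ℂ) (g := fun i => (i : ℤ) + 1 - r)
      (g' := fun i => (i : ℤ) + 1) (e := Fin.natAdd r) (e' := Fin.castAdd r)
      (by intro i; push_cast [Fin.val_natAdd]; ring) (by simp) hr hl]
    simp only [hw, tensor]
  · simp

end MatrixProducts

end

section

open scoped Matrix

/-! ### Positive block matrices in a matrix regular space. -/

section MatrixRegular

variable {V : Type*} [AddCommGroup V] [Module ℂ V]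
  {N : ∀ n : ℕ, Matrix (Fin n) (Fin n) V → ℝ} {K : ∀ n : ℕ, Set (Matrix (Fin n) (Fin n) V)}

theorem IsOperatorSpace.zero (h : IsOperatorSpace N) (n : ℕ) : N n 0 = 0 := by
  simpa using h.smul_eq n 0 0

theorem IsOperatorSpace.nonneg (h : IsOperatorSpace N) {n : ℕ} (v : Matrix (Fin n) (Fin n) V) :
    0 ≤ N n v := by
  have h1 := h.add_le n v (-v)
  have h2 := h.smul_eq n (-1) v
  simp only [neg_smul, one_smul, norm_neg, norm_one, one_mul] at h2
  rw [add_neg_cancel, h.zero, h2] at h1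
  linarith

theorem IsOperatorSpace.submatrix_le (h : IsOperatorSpace N) {p q : ℕ} {e e' : Fin p → Fin q}
    (he : Function.Injective e) (he' : Function.Injective e') (v : Matrix (Fin q) (Fin q) V) :
    N p (v.submatrix e e') ≤ N q v := by
  have h1 := h.sandwich_le p q (selMat e) v (selMat e')ᴴ
  rw [sandwich_eq_triple, selMat_triple, opNorm_conjTranspose] at h1
  have h2 := opNorm_selMat_le he
  have h3 := opNorm_selMat_le he'
  have h4 := opNorm_nonneg (selMat e)
  have h5 := opNorm_nonneg (selMat e')
  have h6 := h.nonneg v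
  calc _ ≤ _ := h1
    _ ≤ 1 * N q v * 1 := by gcongr
    _ = _ := by ring

variable [StarAddMonoid V] [StarModule ℂ V]

theorem IsMatrixOrderedOperatorSpace.blockMat_zero_mem (h : IsMatrixOrderedOperatorSpace N K)
    {p q : ℕ} {v : Matrix (Fin p) (Fin p) V} {w : Matrix (Fin q) (Fin q) V}
    (hv : v ∈ K p) (hw : w ∈ K q) : blockMat v 0 0 w ∈ K (p + q) := by
  have h1 := h.conj_mem p (p + q) (selMat (Fin.castAdd q)) v hv
  have h2 := h.conj_mem q (p + q) (selMat (Fin.natAdd p)) w hw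
  have h3 := h.add_mem _ _ h1 _ h2
  convert h3 using 1
  have hne : ∀ (i : Fin p) (j : Fin q), Fin.castAdd q i ≠ Fin.natAdd p j := by
    intro i j hij
    have := congrArg Fin.val hij
    simp only [Fin.val_castAdd, Fin.val_natAdd] at this
    omega
  ext i j
  simp only [sandwich, selMat, Matrix.add_apply, Matrix.of_apply, Matrix.conjTranspose_apply]
  induction i using Fin.addCases <;> induction j using Fin.addCases <;>
    simp [hne, (hne _ _).symm, apply_ite, ite_smul]

/-- Conjugation by the diagonal sign matrix `1 ⊕ (-1)`. -/
theorem IsMatrixOrderedOperatorSpace.blockMat_neg_mem (h : IsMatrixOrderedOperatorSpace N K)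
    {p q : ℕ} {a : Matrix (Fin p) (Fin p) V} {v : Matrix (Fin p) (Fin q) V}
    {w : Matrix (Fin q) (Fin p) V} {b : Matrix (Fin q) (Fin q) V}
    (hv : blockMat a v w b ∈ K (p + q)) : blockMat a (-v) (-w) b ∈ K (p + q) := by
  have h1 := h.conj_mem (p + q) (p + q)
    (Matrix.diagonal fun i => if (i : ℕ) < p then 1 else -1) _ hv
  convert h1 using 1
  ext i j
  simp only [sandwich, Matrix.diagonal_conjTranspose, Matrix.diagonal_apply, Matrix.of_apply]
  rw [Finset.sum_eq_single i, Finset.sum_eq_single j]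
  · induction i using Fin.addCases <;> induction j using Fin.addCases <;> simp
  · simp +contextual
  · simp
  · intro k _ hk
    simp [hk.symm]
  · simp

/-- Regularity is applied to the self-adjoint matrix with off-diagonal `v`, `vᴴ` and zero diagonal;
a column permutation of `v ⊕ vᴴ` shows that its norm is at most that of `v`. The dominating `u`
supplies the diagonal. -/
theorem IsMatrixRegular.exists_blockMat_mem (h : IsMatrixRegular N K) {n : ℕ}
    {v : Matrix (Fin n) (Fin n) V} (hv : N n v < 1) :
    ∃ a b : Matrix (Fin n) (Fin n) V, N n a < 1 ∧ N n b < 1 ∧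
      blockMat a v vᴴ b ∈ K (n + n) := by
  have hx : N (n + n) (blockMat 0 v vᴴ 0) < 1 := by
    have h1 := h.submatrix_le (e := id)
      (e' := finSumFinEquiv.symm.trans ((Equiv.sumComm _ _).trans finSumFinEquiv))
      Function.injective_id (Equiv.injective _) (blockMat v 0 0 vᴴ)
    rw [h.sum_eq, h.star_isometry, max_self] at h1
    refine lt_of_le_of_lt (le_of_eq_of_le ?_ h1) hv
    congr 1
    ext i j
    induction i using Fin.addCases <;> induction j using Fin.addCases <;>
      simp [-Fin.natAdd_eq_addNat]
  obtain ⟨u, -, hu1, hu2, hu3⟩ := h.exists_dominating (n + n) (blockMat 0 v vᴴ 0)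
    (by simp [conjTranspose_blockMat]) hx
  refine ⟨u.submatrix (Fin.castAdd n) (Fin.castAdd n), u.submatrix (Fin.natAdd n) (Fin.natAdd n),
    (h.submatrix_le (Fin.castAdd_injective _ _) (Fin.castAdd_injective _ _) u).trans_lt hu1,
    (h.submatrix_le (Fin.natAdd_injective _ _) (Fin.natAdd_injective _ _) u).trans_lt hu1, ?_⟩
  have hu : u = blockMat (u.submatrix (Fin.castAdd n) (Fin.castAdd n))
      (u.submatrix (Fin.castAdd n) (Fin.natAdd n)) (u.submatrix (Fin.natAdd n) (Fin.castAdd n))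
      (u.submatrix (Fin.natAdd n) (Fin.natAdd n)) := by
    ext i j
    induction i using Fin.addCases <;> induction j using Fin.addCases <;>
      simp [-Fin.natAdd_eq_addNat]
  set a := u.submatrix (Fin.castAdd n) (Fin.castAdd n)
  set b := u.submatrix (Fin.natAdd n) (Fin.natAdd n)
  set c := u.submatrix (Fin.castAdd n) (Fin.natAdd n)
  set d := u.submatrix (Fin.natAdd n) (Fin.castAdd n)
  have h2 : u - blockMat 0 v vᴴ 0 = blockMat a (c - v) (d - vᴴ) b := by
    rw [hu]
    ext i j
    induction i using Fin.addCases <;> induction j using Fin.addCases <;>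
      simp [-Fin.natAdd_eq_addNat]
  rw [h2] at hu3
  -- The off-diagonal part `c` of `u` is removed by averaging: `u + x` has corner `c + v`, while `u
  -- - x` after the sign flip has corner `v - c`.
  have h3 := h.smul_mem (n + n) (1 / 2) (by norm_num) _
    (h.add_mem _ _ hu2 _ (h.blockMat_neg_mem hu3))
  convert h3 using 1
  rw [hu]
  ext i j
  have key : ∀ x : V, x = (2 : ℂ)⁻¹ • (x + x) := by
    intro x
    rw [← two_smul ℂ x, smul_smul]
    norm_num
  induction i using Fin.addCases <;> induction j using Fin.addCases <;>
    simp [-Fin.natAdd_eq_addNat, ← key]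

end MatrixRegular

end

section

open scoped Matrix

namespace MatrixProducts

variable {m : ℕ} (L : MatrixProducts m)
variable {V : Fin m → Type*} [∀ t, AddCommGroup (V t)] [∀ t, Module ℂ (V t)]

/-- The cone of all `α ⊗_{λ_j} (v₁, …, vₘ) α*`, for matrices with an arbitrary index type. -/
def coneOn (K : ∀ t, ∀ n : ℕ, Set (Matrix (Fin n) (Fin n) (V t))) (I : Type*) :
    Set (Matrix I I (⨂[ℂ] t, V t)) :=
  {u | ∃ (j : ℕ) (α : Matrix I (Fin (L.τ j)) ℂ) (v : ∀ t, Matrix (Fin j) (Fin j) (V t)),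
    0 < j ∧ (∀ t, v t ∈ K t j) ∧ u = triple α (L.tensor j v) αᴴ}

/-- The costs of the representations `α ⊗_{λ_j} (v₁, …, vₘ) β` of a matrix. -/
def costs (N : ∀ t, ∀ n : ℕ, Matrix (Fin n) (Fin n) (V t) → ℝ) (I : Type) [Fintype I]
    [DecidableEq I] (u : Matrix I I (⨂[ℂ] t, V t)) : Set ℝ :=
  {c : ℝ | ∃ (j : ℕ) (α : Matrix I (Fin (L.τ j)) ℂ) (v : ∀ t, Matrix (Fin j) (Fin j) (V t))
    (β : Matrix (Fin (L.τ j)) I ℂ), 0 < j ∧ u = triple α (L.tensor j v) β ∧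
      c = opNorm α * (∏ t, N t j (v t)) * opNorm β}

/-- The norm `‖·‖_λ` of a matrix with an arbitrary finite index type. -/
def lambdaNormOn (N : ∀ t, ∀ n : ℕ, Matrix (Fin n) (Fin n) (V t) → ℝ) (I : Type) [Fintype I]
    [DecidableEq I] (u : Matrix I I (⨂[ℂ] t, V t)) : ℝ := sInf (L.costs N I u)

variable [∀ t, StarAddMonoid (V t)] [∀ t, StarModule ℂ (V t)]

/-- The norm `‖·‖_Λ` of a matrix with an arbitrary finite index type. -/
def bigLambdaNormOn (N : ∀ t, ∀ n : ℕ, Matrix (Fin n) (Fin n) (V t) → ℝ)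
    (K : ∀ t, ∀ n : ℕ, Set (Matrix (Fin n) (Fin n) (V t))) (I : Type) [Fintype I]
    [DecidableEq I] (z : Matrix I I (⨂[ℂ] t, V t)) : ℝ :=
  sInf {c : ℝ | ∃ u u' : Matrix I I (⨂[ℂ] t, V t),
    Matrix.fromBlocks u z zᴴ u' ∈ L.coneOn K (I ⊕ I) ∧
      c = max (L.lambdaNormOn N I u) (L.lambdaNormOn N I u')}

/-- The standing hypotheses on the spaces `V₁, …, Vₘ` and the matrix products `λ`. -/
structure Admissible (N : ∀ t, ∀ n : ℕ, Matrix (Fin n) (Fin n) (V t) → ℝ)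
    (K : ∀ t, ∀ n : ℕ, Set (Matrix (Fin n) (Fin n) (V t))) : Prop where
  regular : ∀ t, IsMatrixRegular (N t) (K t)
  e1 : L.E1
  e2 : L.E2
  e3 : L.E3
  o1 : L.O1
  o2 : L.O2
  o3 : L.O3

variable {L} {N : ∀ t, ∀ n : ℕ, Matrix (Fin n) (Fin n) (V t) → ℝ}
  {K : ∀ t, ∀ n : ℕ, Set (Matrix (Fin n) (Fin n) (V t))}

/-! ### The algebraic cone on the tensor product. -/

section Cone

theorem conj_mem_coneOn {I J : Type*} [Fintype I] [Fintype J] (A : Matrix I J ℂ)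
    {u : Matrix J J (⨂[ℂ] t, V t)} (hu : u ∈ L.coneOn K J) :
    triple A u Aᴴ ∈ L.coneOn K I := by
  obtain ⟨j, α, v, hj, hv, rfl⟩ := hu
  exact ⟨j, A * α, v, hj, hv, by rw [triple_triple, Matrix.conjTranspose_mul]⟩

theorem submatrix_mem_coneOn {I J : Type*} [Fintype I] [Fintype J] [DecidableEq J] (e : I → J)
    {u : Matrix J J (⨂[ℂ] t, V t)} (hu : u ∈ L.coneOn K J) :
    u.submatrix e e ∈ L.coneOn K I := by
  rw [← selMat_triple]
  exact conj_mem_coneOn _ hu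

theorem smul_mem_coneOn {I : Type*} [Fintype I] [DecidableEq I] {r : ℝ} (hr : 0 ≤ r)
    {u : Matrix I I (⨂[ℂ] t, V t)} (hu : u ∈ L.coneOn K I) : (r : ℂ) • u ∈ L.coneOn K I := by
  have h := conj_mem_coneOn ((Real.sqrt r : ℂ) • (1 : Matrix I I ℂ)) hu
  rw [Matrix.conjTranspose_smul, Matrix.conjTranspose_one, smul_triple, triple_smul_right,
    one_triple_one, smul_smul, Complex.star_def, Complex.conj_ofReal, ← Complex.ofReal_mul,
    Real.mul_self_sqrt hr] at h
  exact h

theorem Admissible.fromBlocks_mem_coneOn (h : L.Admissible N K) {I J : Type*} [Fintype I] [Fintype J]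
    {u : Matrix I I (⨂[ℂ] t, V t)} {w : Matrix J J (⨂[ℂ] t, V t)}
    (hu : u ∈ L.coneOn K I) (hw : w ∈ L.coneOn K J) :
    Matrix.fromBlocks u 0 0 w ∈ L.coneOn K (I ⊕ J) := by
  obtain ⟨r, α, x, hr, hx, rfl⟩ := hu
  obtain ⟨s, β, y, hs, hy, rfl⟩ := hw
  obtain ⟨P, -, hP⟩ := h.e2 r s hr hs
  refine ⟨r + s, Matrix.fromBlocks α 0 0 β * P, fun t => blockMat (x t) 0 0 (y t), by omega,
    fun t => (h.regular t).blockMat_zero_mem (hx t) (hy t), ?_⟩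
  rw [Matrix.conjTranspose_mul, ← triple_triple, triple_tensor_diagonal hP,
    Matrix.fromBlocks_conjTranspose, Matrix.conjTranspose_zero, Matrix.conjTranspose_zero,
    triple_fromBlocks]
  simp only [triple_zero]

/-- Addition is the direct sum compressed by the row `(1 1)`. -/
theorem Admissible.add_mem_coneOn (h : L.Admissible N K) {I : Type*} [Fintype I] [DecidableEq I]
    {u w : Matrix I I (⨂[ℂ] t, V t)} (hu : u ∈ L.coneOn K I) (hw : w ∈ L.coneOn K I) :
    u + w ∈ L.coneOn K I := by
  have h1 := conj_mem_coneOn (Matrix.fromCols (1 : Matrix I I ℂ) 1) (h.fromBlocks_mem_coneOn hu hw)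
  rw [Matrix.conjTranspose_fromCols_eq_fromRows_conjTranspose, fromCols_triple_fromRows] at h1
  simpa only [Matrix.conjTranspose_one, one_triple_one, triple_zero, add_zero, zero_add] using h1

theorem Admissible.zero_mem_coneOn (h : L.Admissible N K) {I : Type*} [Fintype I] :
    (0 : Matrix I I (⨂[ℂ] t, V t)) ∈ L.coneOn K I :=
  ⟨1, 0, fun _ => 0, one_pos, fun t => (h.regular t).zero_mem 1, (zero_triple _ _).symm⟩

theorem Admissible.sum_mem_coneOn (h : L.Admissible N K) {I S : Type*} [Fintype I] [DecidableEq I]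
    [Fintype S] {u : S → Matrix I I (⨂[ℂ] t, V t)} (hu : ∀ s, u s ∈ L.coneOn K I) :
    ∑ s, u s ∈ L.coneOn K I := by
  classical
  exact Finset.sum_induction u (· ∈ L.coneOn K I) (fun _ _ ha hb => h.add_mem_coneOn ha hb)
    h.zero_mem_coneOn fun s _ => hu s

theorem Admissible.conjTranspose_eq_of_mem_coneOn (h : L.Admissible N K) {I : Type*} [Fintype I]
    {u : Matrix I I (⨂[ℂ] t, V t)} (hu : u ∈ L.coneOn K I) : uᴴ = u := by
  obtain ⟨j, α, v, hj, hv, rfl⟩ := hu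
  rw [conjTranspose_triple, Matrix.conjTranspose_conjTranspose, conjTranspose_tensor L h.o1 hj]
  congr 2
  funext t
  exact (h.regular t).isSelfAdjoint j _ (hv t)

theorem tensor_mem_coneOn {j : ℕ} (hj : 0 < j) {v : ∀ t, Matrix (Fin j) (Fin j) (V t)}
    (hv : ∀ t, v t ∈ K t j) : L.tensor j v ∈ L.coneOn K (Fin (L.τ j)) :=
  ⟨j, 1, v, hj, hv, by rw [Matrix.conjTranspose_one, one_triple_one]⟩

/-- Tensoring the blocks directly would produce mixed terms that (E2) and (O2) do not control. The
weighted average over sign flips of the off-diagonals stays in the cone and leaves only the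
all-diagonal and all-antidiagonal terms, which `P` maps to the required block. -/
theorem Admissible.fromBlocks_tensor_mem_coneOn (h : L.Admissible N K) {r : ℕ} (hr : 0 < r)
    {a v w b : ∀ t, Matrix (Fin r) (Fin r) (V t)}
    (hx : ∀ t, blockMat (a t) (v t) (w t) (b t) ∈ K t (r + r)) :
    Matrix.fromBlocks (L.tensor r a) (L.tensor r v) (L.tensor r w) (L.tensor r b) ∈
      L.coneOn K (Fin (L.τ r) ⊕ Fin (L.τ r)) := by
  obtain ⟨P, -, hP, hP'⟩ := h.o2 r hr
  set d : Fin (r + r) → Fin (r + r) → Prop := fun i j => ((i : ℕ) < r ↔ (j : ℕ) < r) with hd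
  have key := sum_units_amplify (L.prod (r + r)) (PiTensorProduct.tprod ℂ) d
    (fun t => blockMat (a t) (v t) (w t) (b t))
  have h1 : (fun t => Matrix.of fun i j => if d i j then
      blockMat (a t) (v t) (w t) (b t) i j else 0) = fun t => blockMat (a t) 0 0 (b t) := by
    funext t
    ext i j
    induction i using Fin.addCases <;> induction j using Fin.addCases <;>
      simp [hd, -Fin.natAdd_eq_addNat]
  have h2 : (fun t => Matrix.of fun i j => if d i j then 0 else
      blockMat (a t) (v t) (w t) (b t) i j) = fun t => blockMat 0 (v t) (w t) 0 := by
    funext t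
    ext i j
    induction i using Fin.addCases <;> induction j using Fin.addCases <;>
      simp [hd, -Fin.natAdd_eq_addNat]
  rw [h1, h2] at key
  have hmem : ∑ s : Fin m → ℤˣ, (1 + ∏ t, ((s t : ℤ) : ℂ)) •
      amplify (L.prod (r + r)) (PiTensorProduct.tprod ℂ) (fun t => Matrix.of fun i j =>
        (if d i j then 1 else ((s t : ℤ) : ℂ)) • blockMat (a t) (v t) (w t) (b t) i j) ∈
      L.coneOn K (Fin (L.τ (r + r))) := by
    refine h.sum_mem_coneOn fun s => ?_
    -- Each weight is the real number `0` or `2`, so the sum remains in the cone.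
    have hs : (1 + ∏ t, ((s t : ℤ) : ℂ)) = ((1 + ((∏ t, s t : ℤˣ) : ℤ) : ℝ) : ℂ) := by
      push_cast; rfl
    rw [hs]
    refine smul_mem_coneOn ?_ (tensor_mem_coneOn (by omega) fun t => ?_)
    · rcases Int.units_eq_one_or (∏ t, s t) with h | h <;> rw [h] <;> norm_num
    · rcases Int.units_eq_one_or (s t) with h' | h' <;> rw [h']
      · convert hx t using 1
        ext i j
        simp
      · convert (h.regular t).blockMat_neg_mem (hx t) using 1
        ext i j
        induction i using Fin.addCases <;> induction j using Fin.addCases <;>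
          simp [hd, -Fin.natAdd_eq_addNat]
  rw [key] at hmem
  have h3 := conj_mem_coneOn P (smul_mem_coneOn (r := (2 ^ m)⁻¹) (by positivity) hmem)
  rw [smul_smul] at h3
  have h4 : (((2 ^ m)⁻¹ : ℝ) : ℂ) * 2 ^ m = 1 := by
    push_cast
    exact inv_mul_cancel₀ (pow_ne_zero _ two_ne_zero)
  rw [h4, one_smul, triple_add] at h3
  have h5 := triple_tensor_diagonal hP a b
  have h6 := triple_tensor_antidiagonal hP' v w
  rw [tensor] at h5 h6
  rw [h5, h6, Matrix.fromBlocks_add] at h3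
  simpa using h3

end Cone

/-! ### The gauge `‖·‖_λ` and its Ruan axioms. -/

section LambdaNorm

theorem Admissible.costs_nonneg (h : L.Admissible N K) {I : Type} [Fintype I] [DecidableEq I]
    {u : Matrix I I (⨂[ℂ] t, V t)} {c : ℝ} (hc : c ∈ L.costs N I u) : 0 ≤ c := by
  obtain ⟨j, α, v, β, -, -, rfl⟩ := hc
  exact mul_nonneg (mul_nonneg (opNorm_nonneg _)
    (Finset.prod_nonneg fun t _ => (h.regular t).nonneg _)) (opNorm_nonneg _)

theorem Admissible.lambdaNormOn_le (h : L.Admissible N K) {I : Type} [Fintype I] [DecidableEq I]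
    {j : ℕ} (hj : 0 < j) (α : Matrix I (Fin (L.τ j)) ℂ) (v : ∀ t, Matrix (Fin j) (Fin j) (V t))
    (β : Matrix (Fin (L.τ j)) I ℂ) :
    L.lambdaNormOn N I (triple α (L.tensor j v) β) ≤ opNorm α * (∏ t, N t j (v t)) * opNorm β :=
  csInf_le ⟨0, fun _ hc => h.costs_nonneg hc⟩ ⟨j, α, v, β, hj, rfl, rfl⟩

theorem Admissible.exists_fromBlocks_representation (h : L.Admissible N K) {I J : Type*} [Fintype I] [Fintype J]
    {r s : ℕ} (hr : 0 < r) (hs : 0 < s) (v : ∀ t, Matrix (Fin r) (Fin r) (V t))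
    (w : ∀ t, Matrix (Fin s) (Fin s) (V t))
    (α : Matrix I (Fin (L.τ r)) ℂ) (β : Matrix (Fin (L.τ r)) I ℂ)
    (α' : Matrix J (Fin (L.τ s)) ℂ) (β' : Matrix (Fin (L.τ s)) J ℂ) :
    ∃ P : Matrix (Fin (L.τ r) ⊕ Fin (L.τ s)) (Fin (L.τ (r + s))) ℂ, opNorm P ≤ 1 ∧
      Matrix.fromBlocks (triple α (L.tensor r v) β) 0 0 (triple α' (L.tensor s w) β') =
        triple (Matrix.fromBlocks α 0 0 α' * P)
          (L.tensor (r + s) fun t => blockMat (v t) 0 0 (w t))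
          (Pᴴ * Matrix.fromBlocks β 0 0 β') := by
  obtain ⟨P, hP1, hP⟩ := h.e2 r s hr hs
  refine ⟨P, hP1, ?_⟩
  rw [← triple_triple, triple_tensor_diagonal hP, triple_fromBlocks]
  simp only [triple_zero]

/-- Representable matrices are closed under sums by (E2), and (E1) represents an elementary tensor
in a single entry. This also makes the set of costs nonempty, so the infimum is not the default
value of `sInf`. -/
theorem Admissible.exists_representation (h : L.Admissible N K) {I : Type*} [Fintype I]
    [DecidableEq I] (u : Matrix I I (⨂[ℂ] t, V t)) :
    ∃ (j : ℕ) (α : Matrix I (Fin (L.τ j)) ℂ) (v : ∀ t, Matrix (Fin j) (Fin j) (V t))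
      (β : Matrix (Fin (L.τ j)) I ℂ), 0 < j ∧ u = triple α (L.tensor j v) β := by
  have hadd : ∀ u w : Matrix I I (⨂[ℂ] t, V t),
      (∃ (j : ℕ) (α : Matrix I (Fin (L.τ j)) ℂ) (v : ∀ t, Matrix (Fin j) (Fin j) (V t))
        (β : Matrix (Fin (L.τ j)) I ℂ), 0 < j ∧ u = triple α (L.tensor j v) β) →
      (∃ (j : ℕ) (α : Matrix I (Fin (L.τ j)) ℂ) (v : ∀ t, Matrix (Fin j) (Fin j) (V t))
        (β : Matrix (Fin (L.τ j)) I ℂ), 0 < j ∧ w = triple α (L.tensor j v) β) →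
      ∃ (j : ℕ) (α : Matrix I (Fin (L.τ j)) ℂ) (v : ∀ t, Matrix (Fin j) (Fin j) (V t))
        (β : Matrix (Fin (L.τ j)) I ℂ), 0 < j ∧ u + w = triple α (L.tensor j v) β := by
    rintro _ _ ⟨r, α, v, β, hr, rfl⟩ ⟨s, α', w, β', hs, rfl⟩
    obtain ⟨P, -, hP⟩ := h.exists_fromBlocks_representation hr hs v w α β α' β'
    refine ⟨r + s, (Matrix.fromCols 1 1 : Matrix I (I ⊕ I) ℂ) * (Matrix.fromBlocks α 0 0 α' * P),
      fun t => blockMat (v t) 0 0 (w t),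
      Pᴴ * Matrix.fromBlocks β 0 0 β' * (Matrix.fromRows 1 1 : Matrix (I ⊕ I) I ℂ), by omega, ?_⟩
    rw [← triple_triple, ← hP, fromCols_triple_fromRows]
    simp only [one_triple_one, triple_zero, add_zero, zero_add]
  refine Matrix.induction_on' u ⟨1, 0, fun _ => 0, 0, one_pos, (zero_triple _ _).symm⟩ hadd ?_
  intro i j x
  induction x using PiTensorProduct.induction_on with
  | add x y hx hy =>
    rw [Matrix.single_add]
    exact hadd _ _ hx hy
  | smul_tprod c f =>
    -- At `k = 1` every index tuple is constant, so (E1) gives a matrix `a 0` with `S * L.prod p (a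
    -- 0, …, a 0) * T = 1`; the two matrix units then move this scalar to position `(i, j)`.
    obtain ⟨p, hp, S, T, a, ha⟩ := h.e1 1 one_pos
    have ha1 := (ha fun _ => 0).1 0 fun _ => rfl
    refine ⟨p, c • (Matrix.single i (0 : Fin 1) (1 : ℂ) * S), fun t => Matrix.of fun x y => a 0 x y • f t,
      T * Matrix.single (0 : Fin 1) j (1 : ℂ), hp, ?_⟩
    rw [tensor, amplify_smul_apply, smul_triple]
    refine matrix_ext_dual fun g => ?_
    have hg : (c • triple (Matrix.single i (0 : Fin 1) (1 : ℂ) * S) (Matrix.of fun k l =>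
        L.prod p (fun _ => a 0) k l • PiTensorProduct.tprod ℂ f) (T * Matrix.single (0 : Fin 1) j (1 : ℂ))).map g =
        c • (triple (Matrix.single i (0 : Fin 1) (1 : ℂ) * S) (Matrix.of fun k l =>
        L.prod p (fun _ => a 0) k l • PiTensorProduct.tprod ℂ f) (T * Matrix.single (0 : Fin 1) j (1 : ℂ))).map g := by
      ext k l
      simp
    have hm : (Matrix.of fun k l => L.prod p (fun _ => a 0) k l • PiTensorProduct.tprod ℂ f).map g =
        g (PiTensorProduct.tprod ℂ f) • L.prod p (fun _ => a 0) := by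
      ext k l
      simp [mul_comm]
    rw [hg, map_triple, hm, triple_smul, triple_eq_mul]
    have hS : Matrix.single i (0 : Fin 1) (1 : ℂ) * S * L.prod p (fun _ => a 0) * (T * Matrix.single (0 : Fin 1) j (1 : ℂ)) =
        Matrix.single i j 1 := by
      rw [show Matrix.single i (0 : Fin 1) (1 : ℂ) * S * L.prod p (fun _ => a 0) * (T * Matrix.single (0 : Fin 1) j (1 : ℂ)) =
        Matrix.single i (0 : Fin 1) (1 : ℂ) * (S * L.prod p (fun _ => a 0) * T) * Matrix.single (0 : Fin 1) j (1 : ℂ) by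
          simp only [Matrix.mul_assoc], ha1]
      simp
    rw [hS]
    ext k l
    simp [Matrix.single_apply, apply_ite g]

/-- Rescaling puts all `v_t` in the unit ball and splits the cost evenly between the outer factors.
Balanced factors make direct sums compatible with maxima, since each factor separately has norm at
most `√c`. -/
theorem Admissible.exists_normalized_representation (h : L.Admissible N K) {I : Type} [Fintype I]
    [DecidableEq I] {u : Matrix I I (⨂[ℂ] t, V t)} {c : ℝ} (hc : L.lambdaNormOn N I u < c) :
    ∃ (j : ℕ) (α : Matrix I (Fin (L.τ j)) ℂ) (v : ∀ t, Matrix (Fin j) (Fin j) (V t))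
      (β : Matrix (Fin (L.τ j)) I ℂ), 0 < j ∧ u = triple α (L.tensor j v) β ∧
        (∀ t, N t j (v t) ≤ 1) ∧ opNorm α ^ 2 ≤ c ∧ opNorm β ^ 2 ≤ c := by
  have hne : (L.costs N I u).Nonempty := by
    obtain ⟨j, α, v, β, hj, hu⟩ := h.exists_representation u
    exact ⟨_, j, α, v, β, hj, hu, rfl⟩
  obtain ⟨c', hc', hlt⟩ := exists_lt_of_csInf_lt hne hc
  have hc0 : 0 < c := (h.costs_nonneg hc').trans_lt hlt
  obtain ⟨j, α, v, β, hj, rfl, rfl⟩ := hc'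
  have htriv : triple α (L.tensor j v) β = 0 → ∃ (j' : ℕ) (α' : Matrix I (Fin (L.τ j')) ℂ)
      (v' : ∀ t, Matrix (Fin j') (Fin j') (V t))
      (β' : Matrix (Fin (L.τ j')) I ℂ), 0 < j' ∧ triple α (L.tensor j v) β =
        triple α' (L.tensor j' v') β' ∧
        (∀ t, N t j' (v' t) ≤ 1) ∧ opNorm α' ^ 2 ≤ c ∧ opNorm β' ^ 2 ≤ c := by
    intro h0
    refine ⟨1, 0, fun _ => 0, 0, one_pos, by rw [h0, zero_triple], fun t => ?_, ?_, ?_⟩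
    · rw [(h.regular t).zero]; exact zero_le_one
    · rw [opNorm_zero]; simpa using hc0.le
    · rw [opNorm_zero]; simpa using hc0.le
  -- A vanishing factor makes the represented matrix zero, and the rescaling below would divide by
  -- it.
  by_cases hv : ∃ t, N t j (v t) = 0
  · obtain ⟨t, ht⟩ := hv
    refine htriv ?_
    rw [tensor, amplify_eq_zero _ _ ((h.regular t).eq_zero _ _ ht), triple_zero]
  by_cases hα : opNorm α = 0
  · exact htriv (by rw [eq_zero_of_opNorm_eq_zero hα, zero_triple])
  by_cases hβ : opNorm β = 0
  · exact htriv (by rw [eq_zero_of_opNorm_eq_zero hβ, triple_zero_right])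
  push Not at hv
  have hvpos : ∀ t, 0 < N t j (v t) := fun t => lt_of_le_of_ne ((h.regular t).nonneg _) (hv t).symm
  have hαpos := lt_of_le_of_ne (opNorm_nonneg α) (Ne.symm hα)
  have hβpos := lt_of_le_of_ne (opNorm_nonneg β) (Ne.symm hβ)
  set R := ∏ t, N t j (v t) with hR
  have hRpos : 0 < R := Finset.prod_pos fun t _ => hvpos t
  have hq : ∀ x y : ℝ, 0 < x → 0 < y → (Real.sqrt (R * y / x) * x) ^ 2 = x * R * y := by
    intro x y hx hy
    rw [mul_pow, Real.sq_sqrt (by positivity)]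
    field_simp
  -- Both scaled outer factors have squared norm equal to the full cost `‖α‖ R ‖β‖`, and the product
  -- `R` of the two scalars compensates for normalizing the `v_t`.
  refine ⟨j, (Real.sqrt (R * opNorm β / opNorm α) : ℂ) • α,
    fun t => ((N t j (v t) : ℂ)⁻¹) • v t, (Real.sqrt (R * opNorm α / opNorm β) : ℂ) • β, hj,
    ?_, fun t => ?_, ?_, ?_⟩
  · rw [tensor_smul, smul_triple, triple_smul_right, triple_smul, smul_smul, smul_smul,
      ← Complex.ofReal_mul, ← Real.sqrt_mul (by positivity)]
    have : R * opNorm β / opNorm α * (R * opNorm α / opNorm β) = R ^ 2 := by field_simp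
    rw [this, Real.sqrt_sq hRpos.le, Finset.prod_inv_distrib, hR, Complex.ofReal_prod,
      mul_inv_cancel₀, one_smul]
    rw [← Complex.ofReal_prod]
    exact_mod_cast hRpos.ne'
  · rw [(h.regular t).smul_eq, norm_inv, Complex.norm_real, Real.norm_of_nonneg (hvpos t).le,
      inv_mul_cancel₀ (hv t)]
  · rw [opNorm_smul, Complex.norm_real, Real.norm_of_nonneg (Real.sqrt_nonneg _), hq _ _ hαpos hβpos]
    exact hlt.le
  · rw [opNorm_smul, Complex.norm_real, Real.norm_of_nonneg (Real.sqrt_nonneg _), hq _ _ hβpos hαpos]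
    linarith [mul_comm (opNorm β * R) (opNorm α), mul_comm (opNorm β) R,
      mul_assoc (opNorm α) R (opNorm β)]

theorem Admissible.ruanFamily_lambdaNormOn (h : L.Admissible N K) :
    RuanFamily (fun I [Fintype I] [DecidableEq I] => L.lambdaNormOn N I) where
  nonneg I _ _ u := Real.sInf_nonneg fun _ hc => h.costs_nonneg hc
  triple_le I J _ _ _ _ α u β := by
    have hA := opNorm_nonneg α
    have hB := opNorm_nonneg β
    have hu : ∀ c, L.lambdaNormOn N J u < c →
        L.lambdaNormOn N I (triple α u β) ≤ opNorm α * c * opNorm β := by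
      intro c hc
      have hc0 : 0 ≤ c := (Real.sInf_nonneg fun _ hc => h.costs_nonneg hc).trans hc.le
      obtain ⟨j, α', v, β', hj, rfl, hv, hα, hβ⟩ := h.exists_normalized_representation hc
      rw [triple_triple]
      have h1 := h.lambdaNormOn_le hj (α * α') v (β' * β)
      have h2 : ∏ t, N t j (v t) ≤ 1 :=
        Finset.prod_le_one (fun t _ => (h.regular t).nonneg _) fun t _ => hv t
      have h3 : 0 ≤ ∏ t, N t j (v t) := Finset.prod_nonneg fun t _ => (h.regular t).nonneg _
      have h4 := opNorm_mul_le α α'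
      have h5 := opNorm_mul_le β' β
      have h6 := opNorm_nonneg α'
      have h7 := opNorm_nonneg β'
      -- Arithmetic–geometric mean, from the bounds on the squares.
      have h8 : opNorm α' * opNorm β' ≤ c := by nlinarith [sq_nonneg (opNorm α' - opNorm β')]
      calc _ ≤ _ := h1
        _ ≤ (opNorm α * opNorm α') * 1 * (opNorm β' * opNorm β) :=
            mul_le_mul (mul_le_mul h4 h2 h3 (by positivity)) h5 (opNorm_nonneg _) (by positivity)
        _ = opNorm α * (opNorm α' * opNorm β') * opNorm β := by ring
        _ ≤ _ := by gcongr
    have ht : Filter.Tendsto (fun c => opNorm α * c * opNorm β)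
        (nhdsWithin (L.lambdaNormOn N J u) (Set.Ioi (L.lambdaNormOn N J u)))
        (nhds (opNorm α * L.lambdaNormOn N J u * opNorm β)) :=
      (Continuous.tendsto (by fun_prop) _).mono_left nhdsWithin_le_nhds
    refine ge_of_tendsto ht ?_
    filter_upwards [self_mem_nhdsWithin] with c hc using hu c hc
  sum_le I J _ _ _ _ u w := by
    refine le_of_forall_gt fun c hc => ?_
    obtain ⟨c', hc', hcc⟩ := exists_between hc
    refine lt_of_le_of_lt ?_ hcc
    have hc0 : 0 ≤ c' := (le_max_of_le_left (Real.sInf_nonneg fun _ hc => h.costs_nonneg hc)).trans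
      hc'.le
    obtain ⟨r, α, v, β, hr, rfl, hv, hα, hβ⟩ :=
      h.exists_normalized_representation ((le_max_left _ _).trans_lt hc')
    obtain ⟨s, α', v', β', hs, rfl, hv', hα', hβ'⟩ :=
      h.exists_normalized_representation ((le_max_right _ _).trans_lt hc')
    obtain ⟨P, hP1, hP⟩ := h.exists_fromBlocks_representation hr hs v v' α β α' β'
    rw [hP]
    refine (h.lambdaNormOn_le (by omega) _ _ _).trans ?_
    have hP0 := opNorm_nonneg P
    have h2 : ∏ t, N t (r + s) (blockMat (v t) 0 0 (v' t)) ≤ 1 :=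
      Finset.prod_le_one (fun t _ => (h.regular t).nonneg _) fun t _ => by
        rw [(h.regular t).sum_eq]; exact max_le (hv t) (hv' t)
    have hS : ∀ {x : ℝ}, x ^ 2 ≤ c' → x ≤ Real.sqrt c' := fun hx => Real.le_sqrt_of_sq_le hx
    have h3 : opNorm (Matrix.fromBlocks α 0 0 α' * P) ≤ Real.sqrt c' := by
      refine (opNorm_mul_le _ _).trans ((mul_le_mul_of_nonneg_left hP1 (opNorm_nonneg _)).trans ?_)
      rw [mul_one]
      exact (opNorm_fromBlocks_diagonal_le α α').trans (max_le (hS hα) (hS hα'))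
    have h4 : opNorm (Pᴴ * Matrix.fromBlocks β 0 0 β') ≤ Real.sqrt c' := by
      refine (opNorm_mul_le _ _).trans ?_
      rw [opNorm_conjTranspose]
      refine (mul_le_mul_of_nonneg_right hP1 (opNorm_nonneg _)).trans ?_
      rw [one_mul]
      exact (opNorm_fromBlocks_diagonal_le β β').trans (max_le (hS hβ) (hS hβ'))
    have h5 : 0 ≤ ∏ t, N t (r + s) (blockMat (v t) 0 0 (v' t)) :=
      Finset.prod_nonneg fun t _ => (h.regular t).nonneg _
    calc _ ≤ Real.sqrt c' * 1 * Real.sqrt c' :=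
          mul_le_mul (mul_le_mul h3 h2 h5 (by positivity)) h4 (opNorm_nonneg _) (by positivity)
      _ = c' := by rw [mul_one, Real.mul_self_sqrt hc0]

end LambdaNorm

end MatrixProducts

end

section

open scoped Matrix ComplexOrder

/-! ### Separating points of an algebraic tensor product by product functionals. -/

section Separation

/-- A separating set of functionals yields, for each finite-dimensional subspace, a finite-rank
operator that is the identity there. -/
theorem exists_finite_rank_of_separating {V : Type*} [AddCommGroup V] [Module ℂ V]
    {F : Set (Module.Dual ℂ V)} (hF : ∀ x : V, x ≠ 0 → ∃ f ∈ F, f x ≠ 0)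
    (U : Submodule ℂ V) [FiniteDimensional ℂ U] :
    ∃ (n : ℕ) (f : Fin n → Module.Dual ℂ V) (e : Fin n → V), (∀ i, f i ∈ F) ∧
      ∀ x ∈ U, ∑ i, f i x • e i = x := by
  set S : Set (Module.Dual ℂ U) := (fun f : Module.Dual ℂ V => f.comp U.subtype) '' F with hS
  -- On a finite-dimensional space a separating set of functionals spans the dual, so a basis of the
  -- dual can be drawn from `F`; its predual basis provides the vectors `e`.
  have hspan : Submodule.span ℂ S = ⊤ := by
    refine Submodule.span_eq_top_of_ne_zero fun x hx => ?_
    obtain ⟨f, hf, hfx⟩ := hF x (by simpa using hx)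
    exact ⟨_, ⟨f, hf, rfl⟩, hfx⟩
  let b := Module.Basis.ofSpan hspan.ge
  have hb : ∀ i, b i ∈ S := fun i => Module.Basis.ofSpan_subset hspan.ge ⟨i, rfl⟩
  let b' := b.reindex (Fintype.equivFin _)
  have hb' : ∀ i, ∃ f ∈ F, f.comp U.subtype = b' i := fun i => by
    rw [Module.Basis.reindex_apply]; exact hb _
  choose f hf hfb using hb'
  let e := b'.dualBasis.map (Module.evalEquiv ℂ U).symm
  refine ⟨_, f, fun i => e i, hf, fun x hx => ?_⟩
  have h1 := e.sum_repr ⟨x, hx⟩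
  have h2 : ∀ i, e.repr ⟨x, hx⟩ i = f i x := by
    intro i
    have h3 : b' i ⟨x, hx⟩ = f i x := by rw [← hfb]; rfl
    rw [← h3]
    simp [e]
  have h4 := congrArg U.subtype h1
  simpa [h2] using h4

variable {m : ℕ} {V : Fin m → Type*} [∀ t, AddCommGroup (V t)] [∀ t, Module ℂ (V t)]

/-- A tensor involves only finitely many vectors in each leg, and `U t` is their span. -/
theorem exists_finiteDimensional_of_tensor (w : ⨂[ℂ] t, V t) :
    ∃ U : ∀ t, Submodule ℂ (V t), (∀ t, FiniteDimensional ℂ (U t)) ∧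
      ∀ Q : ∀ t, V t →ₗ[ℂ] V t, (∀ t, ∀ x ∈ U t, Q t x = x) → PiTensorProduct.map Q w = w := by
  induction w using PiTensorProduct.induction_on with
  | smul_tprod c f =>
    refine ⟨fun t => Submodule.span ℂ {f t}, fun t => inferInstance, fun Q hQ => ?_⟩
    rw [map_smul, PiTensorProduct.map_tprod]
    congr 2
    funext t
    exact hQ t _ (Submodule.mem_span_singleton_self _)
  | add x y hx hy =>
    obtain ⟨U, hU, h1⟩ := hx
    obtain ⟨U', hU', h2⟩ := hy
    refine ⟨fun t => U t ⊔ U' t, fun t => inferInstance, fun Q hQ => ?_⟩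
    rw [map_add, h1 Q fun t x hx => hQ t x (Submodule.mem_sup_left hx),
      h2 Q fun t x hx => hQ t x (Submodule.mem_sup_right hx)]

theorem map_sum_smulRight_eq {n : Fin m → ℕ} (f : ∀ t, Fin (n t) → Module.Dual ℂ (V t))
    (e : ∀ t, Fin (n t) → V t) (w : ⨂[ℂ] t, V t) :
    PiTensorProduct.map (fun t => ∑ i, (f t i).smulRight (e t i)) w =
      ∑ i : ∀ t, Fin (n t), PiTensorProduct.dualDistrib
        (PiTensorProduct.tprod ℂ fun t => f t (i t)) w •
          PiTensorProduct.tprod ℂ (fun t => e t (i t)) := by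
  induction w using PiTensorProduct.induction_on with
  | smul_tprod c x =>
    rw [map_smul, PiTensorProduct.map_tprod]
    simp only [LinearMap.sum_apply, LinearMap.smulRight_apply, MultilinearMap.map_sum,
      MultilinearMap.map_smul_univ, map_smul, PiTensorProduct.dualDistrib_apply, Finset.smul_sum,
      smul_assoc]
  | add x y hx hy => simp only [map_add, hx, hy, add_smul, Finset.sum_add_distrib]

/-- A tensor product of finite-rank operators built from functionals in `F t` fixes `w`, and the
coefficients in its expansion are values of product functionals at `w`. -/
theorem eq_zero_of_dualDistrib_eq_zero {F : ∀ t, Set (Module.Dual ℂ (V t))}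
    (hF : ∀ t, ∀ x : V t, x ≠ 0 → ∃ f ∈ F t, f x ≠ 0) {w : ⨂[ℂ] t, V t}
    (hw : ∀ f : ∀ t, Module.Dual ℂ (V t), (∀ t, f t ∈ F t) →
      PiTensorProduct.dualDistrib (PiTensorProduct.tprod ℂ f) w = 0) : w = 0 := by
  obtain ⟨U, hU, h⟩ := exists_finiteDimensional_of_tensor w
  choose n f e hf he using fun t => exists_finite_rank_of_separating (hF t) (U t)
  rw [← h (fun t => ∑ i, (f t i).smulRight (e t i)) fun t x hx => by simpa using he t x hx,
    map_sum_smulRight_eq]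
  exact Finset.sum_eq_zero fun i _ => by rw [hw _ fun t => hf t _, zero_smul]

end Separation

/-! ### Bounded positive functionals on a matrix regular space. -/

section PositiveFunctional

variable {V : Type*} [AddCommGroup V] [Module ℂ V] [StarAddMonoid V] [StarModule ℂ V]

/-- The bounded positive functionals on a matrix ordered operator space. -/
structure IsPositiveFunctional (N : ∀ n : ℕ, Matrix (Fin n) (Fin n) V → ℝ)
    (K : ∀ n : ℕ, Set (Matrix (Fin n) (Fin n) V)) (f : V →ₗ[ℂ] ℂ) : Prop where
  map_star : ∀ x, f (star x) = star (f x)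
  nonneg : ∀ v ∈ K 1, 0 ≤ f (v 0 0)
  bounded : ∃ C : ℝ, 0 ≤ C ∧ ∀ v : Matrix (Fin 1) (Fin 1) V, ‖f (v 0 0)‖ ≤ C * N 1 v

variable {N : ∀ n : ℕ, Matrix (Fin n) (Fin n) V → ℝ} {K : ∀ n : ℕ, Set (Matrix (Fin n) (Fin n) V)}

/-- The quadratic form of `v.map f` at `x` is `f (x* v x)`, and `x* v x` lies in `K 1`. -/
theorem IsPositiveFunctional.posSemidef {f : V →ₗ[ℂ] ℂ} (hf : IsPositiveFunctional N K f)
    (hV : IsMatrixOrderedOperatorSpace N K) {n : ℕ} {v : Matrix (Fin n) (Fin n) V}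
    (hv : v ∈ K n) : (v.map f).PosSemidef := by
  refine .of_dotProduct_mulVec_nonneg ?_ fun x => ?_
  · have h := hV.isSelfAdjoint n v hv
    ext i j
    have h1 := congrFun (congrFun h i) j
    rw [Matrix.conjTranspose_apply] at h1
    rw [Matrix.conjTranspose_apply, Matrix.map_apply, Matrix.map_apply, ← hf.map_star, h1]
  · have h := hf.nonneg _ (hV.conj_mem n 1 (Matrix.of fun i _ => x i) v hv)
    have h1 : f (sandwich (Matrix.of fun i (_ : Fin 1) => x i)ᴴ v (Matrix.of fun i _ => x i) 0 0) =
        star x ⬝ᵥ (v.map f *ᵥ x) := by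
      simp only [sandwich, Matrix.of_apply, map_sum, map_smul, Matrix.conjTranspose_apply,
        smul_eq_mul, dotProduct, Matrix.mulVec, Finset.mul_sum, Matrix.map_apply, Pi.star_apply]
      exact Finset.sum_congr rfl fun _ _ => Finset.sum_congr rfl fun _ _ => by ring
    rwa [h1] at h

/-- A bounded functional is completely bounded. -/
theorem opNorm_map_le {f : V →ₗ[ℂ] ℂ} {C : ℝ} (hC : 0 ≤ C)
    (hf : ∀ v : Matrix (Fin 1) (Fin 1) V, ‖f (v 0 0)‖ ≤ C * N 1 v) (hV : IsOperatorSpace N)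
    {n : ℕ} (v : Matrix (Fin n) (Fin n) V) : opNorm (v.map f) ≤ C * N n v := by
  have hN := hV.nonneg v
  refine opNorm_le_of_mulVec (by positivity) fun x => ?_
  -- With columns `X`, `Y` for `x`, `y`, one has `‖y‖² = f (Y* v X) ≤ C ‖Y‖ ‖v‖ ‖X‖`; cancelling
  -- `‖Y‖` gives the bound.
  set y := v.map f *ᵥ x with hy
  set X : Matrix (Fin n) (Fin 1) ℂ := Matrix.of fun i _ => x i with hX
  set Y : Matrix (Fin n) (Fin 1) ℂ := Matrix.of fun i _ => y i with hY
  have h1 := (hf (sandwich Yᴴ v X)).trans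
    (mul_le_mul_of_nonneg_left (hV.sandwich_le 1 n Yᴴ v X) hC)
  have h2 : f (sandwich Yᴴ v X 0 0) = ((∑ i, ‖y i‖ ^ 2 : ℝ) : ℂ) := by
    have : f (sandwich Yᴴ v X 0 0) = ∑ i, star (y i) * y i := by
      have hyi : ∀ i, star (y i) * y i = ∑ j, star (y i) * (f (v i j) * x j) :=
        fun i => Finset.mul_sum _ _ _
      simp only [hyi]
      simp only [sandwich, Matrix.of_apply, map_sum, map_smul, Matrix.conjTranspose_apply,
        smul_eq_mul, hX, hY]
      exact Finset.sum_congr rfl fun _ _ => Finset.sum_congr rfl fun _ _ => by ring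
    rw [this]
    push_cast
    exact Finset.sum_congr rfl fun i _ => Complex.conj_mul' _
  have hY2 : opNorm Y ^ 2 = ∑ i, ‖y i‖ ^ 2 := opNorm_column_sq Y
  have hX2 : opNorm X ^ 2 = ∑ i, ‖x i‖ ^ 2 := opNorm_column_sq X
  rw [h2, ← hY2, Complex.norm_real, Real.norm_of_nonneg (by positivity), opNorm_conjTranspose] at h1
  rw [← hY2, ← hX2, ← mul_pow]
  have hY0 := opNorm_nonneg Y
  have hX0 := opNorm_nonneg X
  refine pow_le_pow_left₀ hY0 ?_ 2
  rcases hY0.eq_or_lt with h0 | h0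
  · rw [← h0]; positivity
  · have : opNorm Y * opNorm Y ≤ C * N n v * opNorm X * opNorm Y := by
      calc _ = opNorm Y ^ 2 := by ring
        _ ≤ _ := h1
        _ = _ := by ring
    exact le_of_mul_le_mul_right this h0

/-- The `1 × 1` matrix with a given entry. -/
def unitMat (x : V) : Matrix (Fin 1) (Fin 1) V := Matrix.of fun _ _ => x

theorem eq_unitMat (v : Matrix (Fin 1) (Fin 1) V) : v = unitMat (v 0 0) := by
  ext i j
  rw [Subsingleton.elim i 0, Subsingleton.elim j 0]
  rfl

/-- Such a `v` satisfies `-0 ≤ v ≤ 0`, so regularity forces norm `0`. -/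
theorem IsMatrixRegular.eq_zero_of_mem_of_neg_mem (h : IsMatrixRegular N K) {n : ℕ}
    {v : Matrix (Fin n) (Fin n) V} (hv : v ∈ K n) (hv' : -v ∈ K n) : v = 0 := by
  refine h.eq_zero n v (le_antisymm ?_ (h.nonneg v))
  have h1 := h.norm_le n v (h.isSelfAdjoint n v hv) 0 (h.zero_mem n) (by simpa using hv)
    (by simpa using hv')
  rwa [h.zero] at h1

/-- Hahn–Banach separation from the closed convex cone `K 1`, with `V` normed by `N 1`. -/
theorem IsMatrixRegular.exists_real_functional (h : IsMatrixRegular N K) {x : V}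
    (hx : unitMat x ∉ K 1) :
    ∃ (g : V →ₗ[ℝ] ℝ) (C : ℝ), 0 ≤ C ∧ (∀ y, ‖g y‖ ≤ C * N 1 (unitMat y)) ∧
      (∀ y, unitMat y ∈ K 1 → 0 ≤ g y) ∧ g x < 0 := by
  have hadd : ∀ x y : V, unitMat (x + y) = unitMat x + unitMat y := fun _ _ => rfl
  have hsmul : ∀ (c : ℂ) (x : V), unitMat (c • x) = c • unitMat x := fun _ _ => rfl
  let : Norm V := ⟨fun x => N 1 (unitMat x)⟩
  have hnorm : ∀ x : V, ‖x‖ = N 1 (unitMat x) := fun _ => rfl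
  have core : NormedSpace.Core ℂ V :=
    { norm_nonneg := fun x => h.nonneg _
      norm_smul := fun c x => by rw [hnorm, hsmul, h.smul_eq, hnorm]
      norm_triangle := fun x y => by rw [hnorm, hadd]; exact h.add_le _ _ _
      norm_eq_zero_iff := fun x => by
        rw [hnorm]
        constructor
        · intro h0
          exact congrFun (congrFun (h.eq_zero _ _ h0) 0) 0
        · rintro rfl
          exact h.zero 1 }
  let : NormedAddCommGroup V := NormedAddCommGroup.ofCore core
  let : NormedSpace ℂ V := NormedSpace.ofCore core
  let P : ProperCone ℝ V :=
    { carrier := {y | unitMat y ∈ K 1}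
      add_mem' := fun {x y} hx hy => h.add_mem 1 _ hx _ hy
      zero_mem' := h.zero_mem 1
      smul_mem' := fun c x hx => h.smul_mem 1 c c.2 _ hx
      isClosed' := by
        rw [← isSeqClosed_iff_isClosed]
        intro u y hu huy
        refine h.closed 1 fun ε hε => ?_
        obtain ⟨n, hn⟩ := ((Metric.tendsto_atTop.1 huy) ε hε)
        refine ⟨_, hu n, ?_⟩
        have := hn n le_rfl
        rw [dist_comm, dist_eq_norm] at this
        exact this }
  obtain ⟨g, hg, hgx⟩ := ProperCone.hyperplane_separation_point P (x₀ := x) hx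
  exact ⟨g.toLinearMap, ‖g‖, norm_nonneg _, fun y => g.le_opNorm y, hg, hgx⟩

/-- A nonzero `x` has a nonzero self-adjoint part `a`, and as the cone is pointed, `a` or `-a` lies
outside it. A real functional separating that element from the cone extends complex-linearly from
the self-adjoint part. -/
theorem IsMatrixRegular.exists_positiveFunctional (h : IsMatrixRegular N K) {x : V} (hx : x ≠ 0) :
    ∃ f : V →ₗ[ℂ] ℂ, IsPositiveFunctional N K f ∧ f x ≠ 0 := by
  -- `R` and `J` are twice the real and imaginary parts, so `f y = g (R y) + i g (J y)` is twice the
  -- complex extension of `g` restricted to self-adjoint elements.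
  set R : V → V := fun y => y + star y with hR
  set J : V → V := fun y => Complex.I • (star y - y) with hJ
  have hdec : ∀ y, (2 : ℂ) • y = R y + Complex.I • J y := by
    intro y
    simp only [hR, hJ, smul_smul, Complex.I_mul_I, neg_smul, one_smul, two_smul]
    abel
  have hRs : ∀ y, star (R y) = R y := by intro y; simp [hR, add_comm]
  have hJs : ∀ y, star (J y) = J y := by
    intro y
    simp only [hJ, star_smul, star_sub, star_star, Complex.star_def, Complex.conj_I, neg_smul]
    rw [← smul_neg, neg_sub]
  have hext : ∀ g : V →ₗ[ℝ] ℝ, ∃ f : V →ₗ[ℂ] ℂ, ∀ y, f y = g (R y) + Complex.I * g (J y) := by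
    intro g
    have hRs' : ∀ (c : ℝ) y, R (c • y) = c • R y := by
      intro c y
      have : star (c • y) = c • star y := by
        rw [← Complex.coe_smul, star_smul, Complex.star_def, Complex.conj_ofReal, Complex.coe_smul]
      simp only [hR, this, smul_add]
    have hJs' : ∀ (c : ℝ) y, J (c • y) = c • J y := by
      intro c y
      have : star (c • y) = c • star y := by
        rw [← Complex.coe_smul, star_smul, Complex.star_def, Complex.conj_ofReal, Complex.coe_smul]
      simp only [hJ, this, ← smul_sub]
      rw [smul_comm]
    have hRI : ∀ y, R (Complex.I • y) = -J y := by
      intro y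
      simp only [hR, hJ, star_smul, Complex.star_def, Complex.conj_I, smul_sub, neg_smul]
      abel
    have hJI : ∀ y, J (Complex.I • y) = R y := by
      intro y
      simp only [hR, hJ, star_smul, Complex.star_def, Complex.conj_I, smul_sub, neg_smul, smul_neg,
        smul_smul, Complex.I_mul_I, one_smul]
      abel
    have hRa : ∀ y z, R (y + z) = R y + R z := by intro y z; simp only [hR, star_add]; abel
    have hJa : ∀ y z, J (y + z) = J y + J z := by
      intro y z
      simp only [hJ, star_add, ← smul_add]
      congr 1
      abel
    refine ⟨{ toFun := fun y => g (R y) + Complex.I * g (J y)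
              map_add' := fun y z => ?_
              map_smul' := fun c y => ?_ }, fun _ => rfl⟩
    · rw [hRa, hJa, map_add g (R y), map_add g (J y)]
      push_cast
      ring
    · have hc : c • y = c.re • y + c.im • (Complex.I • y) := by
        conv_lhs => rw [← Complex.re_add_im c, add_smul, mul_smul, Complex.coe_smul,
          Complex.coe_smul]
      rw [hc, hRa, hJa, hRs', hRs', hJs', hJs', hRI, hJI]
      simp only [map_add, map_smul, map_neg, smul_eq_mul, RingHom.id_apply]
      conv_rhs => rw [← Complex.re_add_im c]
      push_cast
      linear_combination (-(c.im : ℂ) * g (J y)) * Complex.I_mul_I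
  have hstarN : ∀ y, N 1 (unitMat (star y)) = N 1 (unitMat y) := fun y => h.star_isometry 1 (unitMat y)
  have hRN : ∀ y, N 1 (unitMat (R y)) ≤ 2 * N 1 (unitMat y) := by
    intro y
    refine (h.add_le 1 (unitMat y) (unitMat (star y))).trans ?_
    rw [hstarN]
    linarith
  have hJN : ∀ y, N 1 (unitMat (J y)) ≤ 2 * N 1 (unitMat y) := by
    intro y
    have h1 := h.smul_eq 1 Complex.I (unitMat (star y - y))
    rw [Complex.norm_I, one_mul] at h1
    have h2 := h.add_le 1 (unitMat (star y)) (unitMat (-y))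
    have h3 := h.smul_eq 1 (-1) (unitMat y)
    rw [norm_neg, norm_one, one_mul] at h3
    have h4 : unitMat (-y) = (-1 : ℂ) • unitMat y := by ext; simp [unitMat]
    rw [h4, h3, hstarN, ← h4] at h2
    have h5 : unitMat (star y - y) = unitMat (star y) + unitMat (-y) := by
      ext; simp [unitMat, sub_eq_add_neg]
    calc N 1 (unitMat (J y)) = N 1 (unitMat (star y - y)) := h1
      _ ≤ _ := by rw [h5]; linarith
  have main : ∀ a, star a = a → unitMat a ∉ K 1 → (a = R x ∨ a = -R x ∨ a = J x ∨ a = -J x) →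
      ∃ f : V →ₗ[ℂ] ℂ, IsPositiveFunctional N K f ∧ f x ≠ 0 := by
    intro a ha haK hax
    obtain ⟨g, C, hC, hgC, hg, hga⟩ := h.exists_real_functional haK
    obtain ⟨f, hf⟩ := hext g
    refine ⟨f, ⟨fun y => ?_, fun v hv => ?_, 4 * C, by positivity, fun v => ?_⟩, fun h0 => ?_⟩
    · have h1 : R (star y) = R y := by simp [hR, add_comm]
      have h2 : J (star y) = -J y := by simp only [hJ, star_star, ← smul_neg, neg_sub]
      rw [hf, hf, h1, h2, map_neg]
      simp
    · have hs : star (v 0 0) = v 0 0 := by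
        have := congrFun (congrFun (h.isSelfAdjoint 1 v hv) 0) 0
        simpa using this
      have h1 : R (v 0 0) = v 0 0 + v 0 0 := by simp [hR, hs]
      have h2 : J (v 0 0) = 0 := by simp [hJ, hs]
      rw [hf, h1, h2, map_zero, map_add]
      have := hg (v 0 0) (by rwa [← eq_unitMat])
      simp only [Complex.ofReal_zero, mul_zero, add_zero]
      exact_mod_cast add_nonneg this this
    · rw [hf, eq_unitMat v]
      refine (norm_add_le _ _).trans ?_
      rw [norm_mul, Complex.norm_I, one_mul, Complex.norm_real, Complex.norm_real]
      have h1 := (hgC (R (v 0 0))).trans (mul_le_mul_of_nonneg_left (hRN _) hC)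
      have h2 := (hgC (J (v 0 0))).trans (mul_le_mul_of_nonneg_left (hJN _) hC)
      refine (add_le_add h1 h2).trans (le_of_eq ?_)
      ring
    · rw [hf] at h0
      have hre := congrArg Complex.re h0
      have him := congrArg Complex.im h0
      simp at hre him
      rcases hax with rfl | rfl | rfl | rfl <;> simp [hre, him] at hga
  have hneg : ∀ a, a ≠ 0 → unitMat a ∉ K 1 ∨ unitMat (-a) ∉ K 1 := by
    intro a ha
    by_contra! hc
    have := h.eq_zero_of_mem_of_neg_mem hc.1 hc.2
    exact ha (congrFun (congrFun this 0) 0)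
  by_cases hRx : R x = 0
  · have hJx : J x ≠ 0 := by
      intro h0
      have := hdec x
      rw [hRx, h0, smul_zero, add_zero] at this
      exact hx ((smul_eq_zero.1 this).resolve_left two_ne_zero)
    rcases hneg _ hJx with h1 | h1
    · exact main _ (hJs x) h1 (by simp)
    · exact main _ (by rw [star_neg, hJs x]) h1 (by simp)
  · rcases hneg _ hRx with h1 | h1
    · exact main _ (hRs x) h1 (by simp)
    · exact main _ (by rw [star_neg, hRs x]) h1 (by simp)

end PositiveFunctional

/-! ### Product functionals and definiteness of `‖·‖_Λ`. -/

namespace MatrixProducts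

variable {m : ℕ} {L : MatrixProducts m}
variable {V : Fin m → Type*} [∀ t, AddCommGroup (V t)] [∀ t, Module ℂ (V t)]

theorem map_tensor_dualDistrib (j : ℕ) (v : ∀ t, Matrix (Fin j) (Fin j) (V t))
    (f : ∀ t, Module.Dual ℂ (V t)) :
    (L.tensor j v).map (PiTensorProduct.dualDistrib (PiTensorProduct.tprod ℂ f)) =
      L.prod j fun t => (v t).map (f t) := by
  rw [tensor, map_amplify, ← sum_prod_smul_eq (L.prod j)]
  simp only [PiTensorProduct.dualDistrib_apply, Matrix.map_apply]

/-- This is (O3) with all `p_t = 1`, where the Kronecker product is multiplication of scalars. -/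
theorem posSemidef_prod (hO3 : L.O3) {j : ℕ} (hj : 0 < j)
    {x : Fin m → Matrix (Fin j) (Fin j) ℂ} (hx : ∀ t, (x t).PosSemidef) :
    (L.prod j x).PosSemidef := by
  have h := hO3 j hj (fun _ => 1) (fun t => Matrix.of fun a b => Matrix.of fun _ _ => x t a b)
    fun t => (hx t).submatrix (Prod.fst : Fin j × Fin 1 → Fin j)
  have h1 := h.submatrix fun a : Fin (L.τ j) => (a, fun _ => (0 : Fin 1))
  convert h1 using 1
  ext a b
  rw [← sum_prod_smul_eq (L.prod j) x]
  change _ = amplify (L.prod j) (kronecker fun _ => 1) _ a b (fun _ => 0) fun _ => 0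
  simp [amplify, kronecker, Matrix.sum_apply, mul_comm]

variable [∀ t, StarAddMonoid (V t)] [∀ t, StarModule ℂ (V t)]
  {N : ∀ t, ∀ n : ℕ, Matrix (Fin n) (Fin n) (V t) → ℝ}
  {K : ∀ t, ∀ n : ℕ, Set (Matrix (Fin n) (Fin n) (V t))}

theorem Admissible.posSemidef_map (h : L.Admissible N K) {f : ∀ t, Module.Dual ℂ (V t)}
    (hf : ∀ t, IsPositiveFunctional (N t) (K t) (f t)) {I : Type*} [Fintype I]
    {u : Matrix I I (⨂[ℂ] t, V t)} (hu : u ∈ L.coneOn K I) :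
    (u.map (PiTensorProduct.dualDistrib (PiTensorProduct.tprod ℂ f))).PosSemidef := by
  obtain ⟨j, α, v, hj, hv, rfl⟩ := hu
  rw [map_triple, triple_eq_mul, map_tensor_dualDistrib]
  exact (posSemidef_prod h.o3 hj fun t =>
    (hf t).posSemidef (h.regular t).toIsMatrixOrderedOperatorSpace
      (hv t)).mul_mul_conjTranspose_same _

/-- Bounded functionals are completely bounded, and (E3) bounds `λ_j` uniformly in `j`, so the
constant does not depend on the representation. -/
theorem Admissible.exists_opNorm_map_le (h : L.Admissible N K) {f : ∀ t, Module.Dual ℂ (V t)}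
    (hf : ∀ t, IsPositiveFunctional (N t) (K t) (f t)) :
    ∃ C : ℝ, 0 ≤ C ∧ ∀ (I : Type) [Fintype I] [DecidableEq I] (u : Matrix I I (⨂[ℂ] t, V t))
      (c : ℝ), L.lambdaNormOn N I u < c →
        opNorm (u.map (PiTensorProduct.dualDistrib (PiTensorProduct.tprod ℂ f))) ≤ C * c := by
  obtain ⟨-, C, hC⟩ := h.e3
  choose D hD hfD using fun t => (hf t).bounded
  have hD' : 0 ≤ ∏ t, D t := Finset.prod_nonneg fun t _ => hD t
  refine ⟨|C| * ∏ t, D t, by positivity, fun I _ _ u c hc => ?_⟩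
  obtain ⟨j, α, v, β, hj, rfl, hv, hα, hβ⟩ := h.exists_normalized_representation hc
  rw [map_triple, triple_eq_mul, map_tensor_dualDistrib]
  have h1 := hC j hj fun t => (v t).map (f t)
  have h2 : ∏ t, opNorm ((v t).map (f t)) ≤ ∏ t, D t := by
    refine Finset.prod_le_prod (fun t _ => opNorm_nonneg _) fun t _ => ?_
    refine (opNorm_map_le (hD t) (hfD t) (h.regular t).toIsOperatorSpace (v t)).trans ?_
    exact mul_le_of_le_one_right (hD t) (hv t)
  have h3 : 0 ≤ ∏ t, opNorm ((v t).map (f t)) := Finset.prod_nonneg fun t _ => opNorm_nonneg _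
  have h4 : opNorm (L.prod j fun t => (v t).map (f t)) ≤ |C| * ∏ t, D t :=
    h1.trans ((mul_le_mul_of_nonneg_right (le_abs_self C) h3).trans
      (mul_le_mul_of_nonneg_left h2 (abs_nonneg C)))
  have h5 := opNorm_nonneg α
  have h6 := opNorm_nonneg β
  have h7 : opNorm α * opNorm β ≤ c := by nlinarith [sq_nonneg (opNorm α - opNorm β)]
  calc _ ≤ opNorm α * opNorm (L.prod j fun t => (v t).map (f t)) * opNorm β :=
        (opNorm_mul_le _ _).trans (mul_le_mul_of_nonneg_right (opNorm_mul_le _ _) h6)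
    _ ≤ opNorm α * (|C| * ∏ t, D t) * opNorm β := by gcongr
    _ = (|C| * ∏ t, D t) * (opNorm α * opNorm β) := by ring
    _ ≤ _ := by gcongr

/-- A product `φ` of positive functionals makes the block positive semidefinite, whence `|φ(z_ab)|²
≤ φ(u_aa) φ(u'_bb) ≤ (C c)²` for every `c > 0`. Such `φ` separate points. -/
theorem Admissible.eq_zero_of_fromBlocks_mem (h : L.Admissible N K) {I : Type} [Fintype I]
    [DecidableEq I] {z : Matrix I I (⨂[ℂ] t, V t)}
    (hz : ∀ c : ℝ, 0 < c → ∃ u u', Matrix.fromBlocks u z zᴴ u' ∈ L.coneOn K (I ⊕ I) ∧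
      L.lambdaNormOn N I u < c ∧ L.lambdaNormOn N I u' < c) : z = 0 := by
  ext a b
  refine eq_zero_of_dualDistrib_eq_zero (F := fun t => {f | IsPositiveFunctional (N t) (K t) f})
    (fun t x hx => (h.regular t).exists_positiveFunctional hx) fun f hf => ?_
  set φ := PiTensorProduct.dualDistrib (PiTensorProduct.tprod ℂ f) with hφ
  obtain ⟨C, hC, hCu⟩ := h.exists_opNorm_map_le hf
  have key : ∀ c : ℝ, 0 < c → ‖φ (z a b)‖ ≤ C * c := by
    intro c hc
    obtain ⟨u, u', hmem, hu, hu'⟩ := hz c hc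
    -- The `2 × 2` principal submatrix on row `a` of the first block and row `b` of the second has
    -- `φ (z a b)` off the diagonal.
    have hP := (h.posSemidef_map hf hmem).submatrix ![Sum.inl a, Sum.inr b]
    have h0 := hP.det_nonneg
    have hH := hP.1.apply 1 0
    rw [Matrix.det_fin_two, ← hH] at h0
    simp at h0
    have h1 := (norm_apply_le_opNorm _ a a).trans (hCu I u c hu)
    have h2 := (norm_apply_le_opNorm _ b b).trans (hCu I u' c hu')
    rw [Complex.mul_conj'] at h0
    have h3 := (Complex.le_def.1 h0).1.trans (Complex.re_le_norm _)
    rw [norm_mul, ← Complex.ofReal_pow, Complex.ofReal_re] at h3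
    refine le_of_sq_le_sq (h3.trans ?_) (by positivity)
    rw [sq]
    exact mul_le_mul h1 h2 (norm_nonneg _) (by positivity)
  refine norm_eq_zero.1 (le_antisymm (le_of_forall_pos_le_add fun ε hε => ?_) (norm_nonneg _))
  refine (key (ε / (C + 1)) (by positivity)).trans ?_
  rw [zero_add, mul_div_assoc', div_le_iff₀ (by positivity)]
  nlinarith

end MatrixProducts

end

section

open scoped Matrix

namespace MatrixProducts

variable {m : ℕ} {L : MatrixProducts m}
variable {V : Fin m → Type*} [∀ t, AddCommGroup (V t)] [∀ t, Module ℂ (V t)]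
  [∀ t, StarAddMonoid (V t)] [∀ t, StarModule ℂ (V t)]
  {N : ∀ t, ∀ n : ℕ, Matrix (Fin n) (Fin n) (V t) → ℝ}
  {K : ∀ t, ∀ n : ℕ, Set (Matrix (Fin n) (Fin n) (V t))}

/-! ### The norm `‖·‖_Λ`: Ruan's axioms, the subcross bound and domination. -/

section BigLambda

variable {I : Type} [Fintype I] [DecidableEq I]

theorem Admissible.bigLambdaNormOn_le (h : L.Admissible N K) {u z u' : Matrix I I (⨂[ℂ] t, V t)}
    (hz : Matrix.fromBlocks u z zᴴ u' ∈ L.coneOn K (I ⊕ I)) :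
    L.bigLambdaNormOn N K I z ≤ max (L.lambdaNormOn N I u) (L.lambdaNormOn N I u') := by
  refine csInf_le ⟨0, ?_⟩ ⟨u, u', hz, rfl⟩
  rintro _ ⟨u, u', -, rfl⟩
  exact le_max_of_le_left (h.ruanFamily_lambdaNormOn.nonneg I u)

theorem Admissible.bigLambdaNormOn_nonneg (h : L.Admissible N K)
    (z : Matrix I I (⨂[ℂ] t, V t)) : 0 ≤ L.bigLambdaNormOn N K I z := by
  refine Real.sInf_nonneg ?_
  rintro _ ⟨u, u', -, rfl⟩
  exact le_max_of_le_left (h.ruanFamily_lambdaNormOn.nonneg I u)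

theorem Admissible.lambdaNormOn_tensor_le (h : L.Admissible N K) {j : ℕ} (hj : 0 < j)
    (v : ∀ t, Matrix (Fin j) (Fin j) (V t)) :
    L.lambdaNormOn N (Fin (L.τ j)) (L.tensor j v) ≤ ∏ t, N t j (v t) := by
  have h1 := h.lambdaNormOn_le hj (1 : Matrix (Fin (L.τ j)) (Fin (L.τ j)) ℂ) v 1
  rw [one_triple_one] at h1
  have h2 := opNorm_one_le (I := Fin (L.τ j))
  have h3 : 0 ≤ ∏ t, N t j (v t) := Finset.prod_nonneg fun t _ => (h.regular t).nonneg _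
  have h4 := opNorm_nonneg (1 : Matrix (Fin (L.τ j)) (Fin (L.τ j)) ℂ)
  calc _ ≤ _ := h1
    _ ≤ 1 * (∏ t, N t j (v t)) * 1 := by gcongr
    _ = _ := by ring

/-- Positive completions of the individual `v_t` tensor to a positive completion of their product.
-/
theorem Admissible.exists_fromBlocks_tensor_mem (h : L.Admissible N K) {j : ℕ} (hj : 0 < j)
    {v : ∀ t, Matrix (Fin j) (Fin j) (V t)} (hv : ∀ t, N t j (v t) < 1) :
    ∃ u u', Matrix.fromBlocks u (L.tensor j v) (L.tensor j v)ᴴ u' ∈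
      L.coneOn K (Fin (L.τ j) ⊕ Fin (L.τ j)) ∧
      L.lambdaNormOn N _ u ≤ 1 ∧ L.lambdaNormOn N _ u' ≤ 1 := by
  choose a b ha hb hab using fun t => (h.regular t).exists_blockMat_mem (hv t)
  have hle : ∀ w : ∀ t, Matrix (Fin j) (Fin j) (V t), (∀ t, N t j (w t) < 1) →
      L.lambdaNormOn N _ (L.tensor j w) ≤ 1 := fun w hw =>
    (h.lambdaNormOn_tensor_le hj w).trans
      (Finset.prod_le_one (fun t _ => (h.regular t).nonneg _) fun t _ => (hw t).le)
  refine ⟨L.tensor j a, L.tensor j b, ?_, hle a ha, hle b hb⟩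
  rw [conjTranspose_tensor L h.o1 hj]
  exact h.fromBlocks_tensor_mem_coneOn hj hab

theorem triple_fromBlocks_mem_coneOn {J : Type*} [Fintype J]
    {u z u' : Matrix J J (⨂[ℂ] t, V t)} (hz : Matrix.fromBlocks u z zᴴ u' ∈ L.coneOn K (J ⊕ J))
    (α : Matrix I J ℂ) (β : Matrix J I ℂ) :
    Matrix.fromBlocks (triple α u αᴴ) (triple α z β) (triple α z β)ᴴ (triple βᴴ u' β) ∈
      L.coneOn K (I ⊕ I) := by
  have h1 := conj_mem_coneOn (Matrix.fromBlocks α 0 0 βᴴ) hz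
  rwa [Matrix.fromBlocks_conjTranspose, Matrix.conjTranspose_zero,
    Matrix.conjTranspose_conjTranspose, triple_fromBlocks, ← conjTranspose_triple] at h1

/-- Dividing by bounds strictly above the norms reaches the open unit ball, which regularity
requires, even when some `v_t` is zero. -/
theorem Admissible.exists_rescaled (h : L.Admissible N K) {j : ℕ}
    (v : ∀ t, Matrix (Fin j) (Fin j) (V t)) {c : Fin m → ℝ} (hc : ∀ t, N t j (v t) < c t) :
    ∃ w : ∀ t, Matrix (Fin j) (Fin j) (V t), (∀ t, N t j (w t) < 1) ∧
      L.tensor j v = ((∏ t, c t : ℝ) : ℂ) • L.tensor j w := by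
  have hc0 : ∀ t, 0 < c t := fun t => ((h.regular t).nonneg _).trans_lt (hc t)
  refine ⟨fun t => ((c t : ℂ)⁻¹) • v t, fun t => ?_, ?_⟩
  · rw [(h.regular t).smul_eq, norm_inv, Complex.norm_real, Real.norm_of_nonneg (hc0 t).le,
      inv_mul_lt_iff₀ (hc0 t), mul_one]
    exact hc t
  · rw [tensor_smul, smul_smul, Finset.prod_inv_distrib, Complex.ofReal_prod, mul_inv_cancel₀,
      one_smul]
    rw [← Complex.ofReal_prod]
    exact_mod_cast (Finset.prod_pos fun t _ => hc0 t).ne'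

/-- Guarantees that the infimum defining `‖·‖_Λ` runs over a nonempty set. -/
theorem Admissible.exists_fromBlocks_mem (h : L.Admissible N K) (z : Matrix I I (⨂[ℂ] t, V t)) :
    ∃ u u', Matrix.fromBlocks u z zᴴ u' ∈ L.coneOn K (I ⊕ I) := by
  obtain ⟨j, α, v, β, hj, rfl⟩ := h.exists_representation z
  obtain ⟨w, hw, hvw⟩ := h.exists_rescaled v (c := fun t => N t j (v t) + 1) fun t => by linarith
  obtain ⟨u, u', hmem, -, -⟩ := h.exists_fromBlocks_tensor_mem hj hw
  rw [hvw, triple_smul, ← smul_triple]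
  exact ⟨_, _, triple_fromBlocks_mem_coneOn hmem _ β⟩

theorem Admissible.exists_fromBlocks_mem_of_lt (h : L.Admissible N K)
    {z : Matrix I I (⨂[ℂ] t, V t)} {c : ℝ} (hc : L.bigLambdaNormOn N K I z < c) :
    ∃ u u', Matrix.fromBlocks u z zᴴ u' ∈ L.coneOn K (I ⊕ I) ∧
      L.lambdaNormOn N I u < c ∧ L.lambdaNormOn N I u' < c := by
  obtain ⟨u₀, u₀', h₀⟩ := h.exists_fromBlocks_mem z
  obtain ⟨_, ⟨u, u', hmem, rfl⟩, hlt⟩ := exists_lt_of_csInf_lt (⟨_, u₀, u₀', h₀, rfl⟩ :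
    {c : ℝ | ∃ u u' : Matrix I I (⨂[ℂ] t, V t), Matrix.fromBlocks u z zᴴ u' ∈ L.coneOn K (I ⊕ I) ∧
      c = max (L.lambdaNormOn N I u) (L.lambdaNormOn N I u')}.Nonempty) hc
  exact ⟨u, u', hmem, (le_max_left _ _).trans_lt hlt, (le_max_right _ _).trans_lt hlt⟩

theorem Admissible.bigLambdaNormOn_zero (h : L.Admissible N K) :
    L.bigLambdaNormOn N K I 0 = 0 := by
  refine le_antisymm ?_ (h.bigLambdaNormOn_nonneg 0)
  have h1 := h.bigLambdaNormOn_le (u := (0 : Matrix I I (⨂[ℂ] t, V t))) (z := 0) (u' := 0)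
    (by simpa using h.zero_mem_coneOn)
  rwa [h.ruanFamily_lambdaNormOn.zero (I := I), max_self] at h1

theorem Admissible.ruanFamily_bigLambdaNormOn (h : L.Admissible N K) :
    RuanFamily (fun I [Fintype I] [DecidableEq I] => L.bigLambdaNormOn N K I) where
  nonneg I _ _ u := h.bigLambdaNormOn_nonneg u
  triple_le I J _ _ _ _ α z β := by
    have hl := h.ruanFamily_lambdaNormOn
    rcases (opNorm_nonneg α).eq_or_lt with hα | hα
    · rw [eq_zero_of_opNorm_eq_zero hα.symm, zero_triple, h.bigLambdaNormOn_zero, opNorm_zero,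
        zero_mul, zero_mul]
    rcases (opNorm_nonneg β).eq_or_lt with hβ | hβ
    · rw [eq_zero_of_opNorm_eq_zero hβ.symm, triple_zero_right, h.bigLambdaNormOn_zero, opNorm_zero,
        mul_zero]
    have key : ∀ c, L.bigLambdaNormOn N K J z < c →
        L.bigLambdaNormOn N K I (triple α z β) ≤ opNorm α * c * opNorm β := by
      intro c hc
      have hc0 : 0 ≤ c := (h.bigLambdaNormOn_nonneg z).trans hc.le
      obtain ⟨u, u', hmem, hu, hu'⟩ := h.exists_fromBlocks_mem_of_lt hc
      -- Conjugation bounds the diagonal corners by `‖α‖² c` and `‖β‖² c`. Replacing `α`, `β` by `s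
      -- α`, `s⁻¹ β` leaves `α z β` unchanged and equalizes both bounds at `‖α‖ c ‖β‖`.
      set s : ℝ := Real.sqrt (opNorm β / opNorm α) with hs
      have hs0 : 0 < s := Real.sqrt_pos.2 (by positivity)
      have hs2 : s ^ 2 = opNorm β / opNorm α := Real.sq_sqrt (by positivity)
      have hsc : (s : ℂ) ≠ 0 := by exact_mod_cast hs0.ne'
      have hz : triple ((s : ℂ) • α) z ((s : ℂ)⁻¹ • β) = triple α z β := by
        rw [smul_triple, triple_smul_right, smul_smul, mul_inv_cancel₀ hsc, one_smul]
      have h1 := h.bigLambdaNormOn_le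
        (triple_fromBlocks_mem_coneOn hmem ((s : ℂ) • α) ((s : ℂ)⁻¹ • β))
      rw [hz] at h1
      refine h1.trans (max_le ?_ ?_)
      · refine (hl.triple_le I J _ _ _).trans ?_
        rw [opNorm_conjTranspose, opNorm_smul, Complex.norm_real, Real.norm_of_nonneg hs0.le]
        calc s * opNorm α * L.lambdaNormOn N J u * (s * opNorm α)
            ≤ s * opNorm α * c * (s * opNorm α) := by gcongr
          _ = s ^ 2 * opNorm α ^ 2 * c := by ring
          _ = _ := by rw [hs2]; field_simp
      · refine (hl.triple_le I J _ _ _).trans ?_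
        rw [opNorm_conjTranspose, opNorm_smul, norm_inv, Complex.norm_real,
          Real.norm_of_nonneg hs0.le]
        calc s⁻¹ * opNorm β * L.lambdaNormOn N J u' * (s⁻¹ * opNorm β)
            ≤ s⁻¹ * opNorm β * c * (s⁻¹ * opNorm β) := by gcongr
          _ = (s ^ 2)⁻¹ * opNorm β ^ 2 * c := by field_simp
          _ = _ := by rw [hs2]; field_simp
    have ht : Filter.Tendsto (fun c => opNorm α * c * opNorm β)
        (nhdsWithin (L.bigLambdaNormOn N K J z) (Set.Ioi (L.bigLambdaNormOn N K J z)))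
        (nhds (opNorm α * L.bigLambdaNormOn N K J z * opNorm β)) :=
      (Continuous.tendsto (by fun_prop) _).mono_left nhdsWithin_le_nhds
    refine ge_of_tendsto ht ?_
    filter_upwards [self_mem_nhdsWithin] with c hc using key c hc
  sum_le I J _ _ _ _ z w := by
    have hl := h.ruanFamily_lambdaNormOn
    refine le_of_forall_gt fun c hc => ?_
    obtain ⟨u, u', hmem, hu, hu'⟩ := h.exists_fromBlocks_mem_of_lt ((le_max_left _ _).trans_lt hc)
    obtain ⟨x, x', hmem', hx, hx'⟩ := h.exists_fromBlocks_mem_of_lt ((le_max_right _ _).trans_lt hc)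
    -- The canonical shuffle turns a direct sum of `2 × 2` blocks into a `2 × 2` block of direct
    -- sums.
    have h1 := submatrix_mem_coneOn (Equiv.sumSumSumComm I J I J)
      (h.fromBlocks_mem_coneOn hmem hmem')
    have h2 : (Matrix.fromBlocks (Matrix.fromBlocks u z zᴴ u') 0 0
        (Matrix.fromBlocks x w wᴴ x')).submatrix (Equiv.sumSumSumComm I J I J)
          (Equiv.sumSumSumComm I J I J) =
        Matrix.fromBlocks (Matrix.fromBlocks u 0 0 x) (Matrix.fromBlocks z 0 0 w)
          (Matrix.fromBlocks z 0 0 w)ᴴ (Matrix.fromBlocks u' 0 0 x') := by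
      rw [Matrix.fromBlocks_conjTranspose, Matrix.conjTranspose_zero, Matrix.conjTranspose_zero]
      ext i j
      rcases i with (i | i) | (i | i) <;> rcases j with (j | j) | (j | j) <;> rfl
    rw [h2] at h1
    refine (h.bigLambdaNormOn_le h1).trans_lt (max_lt ?_ ?_)
    · exact (hl.sum_le I J u x).trans_lt (max_lt hu hx)
    · exact (hl.sum_le I J u' x').trans_lt (max_lt hu' hx')

theorem Admissible.eq_zero_of_bigLambdaNormOn_eq_zero (h : L.Admissible N K)
    {z : Matrix I I (⨂[ℂ] t, V t)} (hz : L.bigLambdaNormOn N K I z = 0) : z = 0 :=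
  h.eq_zero_of_fromBlocks_mem fun c hc => h.exists_fromBlocks_mem_of_lt (by rwa [hz])

/-- Interchanging the two block rows and columns swaps `z` with `zᴴ`. -/
theorem Admissible.bigLambdaNormOn_conjTranspose_le (h : L.Admissible N K)
    (z : Matrix I I (⨂[ℂ] t, V t)) :
    L.bigLambdaNormOn N K I zᴴ ≤ L.bigLambdaNormOn N K I z := by
  refine le_of_forall_gt fun c hc => ?_
  obtain ⟨u, u', hmem, hu, hu'⟩ := h.exists_fromBlocks_mem_of_lt hc
  have h1 := submatrix_mem_coneOn Sum.swap hmem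
  rw [Matrix.fromBlocks_submatrix_sum_swap_sum_swap] at h1
  have h2 := h.bigLambdaNormOn_le (z := zᴴ) (by rwa [Matrix.conjTranspose_conjTranspose])
  exact h2.trans_lt (max_lt hu' hu)

theorem Admissible.bigLambdaNormOn_tensor_le (h : L.Admissible N K) {j : ℕ} (hj : 0 < j)
    (v : ∀ t, Matrix (Fin j) (Fin j) (V t)) :
    L.bigLambdaNormOn N K _ (L.tensor j v) ≤ ∏ t, N t j (v t) := by
  -- Positive completions exist only in the open unit ball, so the norms are enlarged by `δ`, which
  -- then tends to `0`.
  have key : ∀ δ : ℝ, 0 < δ → L.bigLambdaNormOn N K _ (L.tensor j v) ≤ ∏ t, (N t j (v t) + δ) := by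
    intro δ hδ
    obtain ⟨w, hw, hvw⟩ := h.exists_rescaled v (c := fun t => N t j (v t) + δ) fun t => by linarith
    obtain ⟨u, u', hmem, hu, hu'⟩ := h.exists_fromBlocks_tensor_mem hj hw
    have hp : 0 ≤ ∏ t, (N t j (v t) + δ) :=
      Finset.prod_nonneg fun t _ => add_nonneg ((h.regular t).nonneg _) hδ.le
    have h1 := h.ruanFamily_bigLambdaNormOn.smul_le ((∏ t, (N t j (v t) + δ) : ℝ) : ℂ) (L.tensor j w)
    rw [← hvw, Complex.norm_real, Real.norm_of_nonneg hp] at h1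
    exact h1.trans (mul_le_of_le_one_right hp ((h.bigLambdaNormOn_le hmem).trans (max_le hu hu')))
  have ht : Filter.Tendsto (fun δ : ℝ => ∏ t, (N t j (v t) + δ)) (nhdsWithin 0 (Set.Ioi 0))
      (nhds (∏ t, N t j (v t))) := by
    have h1 : Continuous fun δ : ℝ => ∏ t, (N t j (v t) + δ) := by fun_prop
    have h2 := h1.tendsto 0
    simp only [add_zero] at h2
    exact h2.mono_left nhdsWithin_le_nhds
  refine ge_of_tendsto ht ?_
  filter_upwards [self_mem_nhdsWithin] with δ hδ using key δ hδ

/-- Half the sum of `(1;1)(v + u)(1 1)` and `(1;-1)(u - v)(1 -1)` is the block with diagonal `u`,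
`u` and off-diagonal `v`, `v`. Self-adjointness of `v` comes from that of `u ± v`. The bound is by
the `λ`-norm of `u`, which the comparison of `Λ`-norms must still improve. -/
theorem Admissible.bigLambdaNormOn_le_of_dominated (h : L.Admissible N K)
    {v u : Matrix I I (⨂[ℂ] t, V t)} (hadd : v + u ∈ L.coneOn K I) (hsub : u - v ∈ L.coneOn K I) :
    L.bigLambdaNormOn N K I v ≤ L.lambdaNormOn N I u := by
  have hmem : Matrix.fromBlocks u v vᴴ u ∈ L.coneOn K (I ⊕ I) := by
    have hu := h.conjTranspose_eq_of_mem_coneOn hadd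
    have hv := h.conjTranspose_eq_of_mem_coneOn hsub
    have hvs : vᴴ = v := by
      rw [Matrix.conjTranspose_add] at hu
      rw [Matrix.conjTranspose_sub] at hv
      have h2 : (2 : ℂ) • vᴴ = (2 : ℂ) • v := by
        calc (2 : ℂ) • vᴴ = (vᴴ + uᴴ) - (uᴴ - vᴴ) := by rw [two_smul]; abel
          _ = (v + u) - (u - v) := by rw [hu, hv]
          _ = _ := by rw [two_smul]; abel
      exact (smul_right_injective _ (two_ne_zero (α := ℂ))) h2
    have h1 := conj_mem_coneOn (Matrix.fromRows (1 : Matrix I I ℂ) (1 : Matrix I I ℂ)) hadd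
    have h2 := conj_mem_coneOn (Matrix.fromRows (1 : Matrix I I ℂ) (-1 : Matrix I I ℂ)) hsub
    have h3 := smul_mem_coneOn (r := 1 / 2) (by norm_num) (h.add_mem_coneOn h1 h2)
    rw [Matrix.conjTranspose_fromRows_eq_fromCols_conjTranspose,
      Matrix.conjTranspose_fromRows_eq_fromCols_conjTranspose, fromRows_triple_fromCols,
      fromRows_triple_fromCols, Matrix.fromBlocks_add, Matrix.fromBlocks_smul] at h3
    simp only [Matrix.conjTranspose_neg, Matrix.conjTranspose_one, neg_triple, triple_neg_right,
      one_triple_one, neg_neg] at h3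
    rw [show v + u + (u - v) = u + u by abel, show v + u + -(u - v) = v + v by abel,
      half_smul_add_self, half_smul_add_self] at h3
    rwa [hvs]
  simpa using h.bigLambdaNormOn_le hmem

/-- Compressing the block with diagonal `a`, `b` and off-diagonal `v` by `(1 ±1)` and halving gives
`(a + b)/2 ± v`, so `u = (a + b)/2` dominates. -/
theorem Admissible.exists_dominating_of_lt (h : L.Admissible N K)
    {v : Matrix I I (⨂[ℂ] t, V t)} (hv : vᴴ = v) {c : ℝ} (hc : L.bigLambdaNormOn N K I v < c) :
    ∃ u ∈ L.coneOn K I, L.lambdaNormOn N I u < c ∧ v + u ∈ L.coneOn K I ∧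
      u - v ∈ L.coneOn K I := by
  have hl := h.ruanFamily_lambdaNormOn
  obtain ⟨a, b, hmem, ha, hb⟩ := h.exists_fromBlocks_mem_of_lt hc
  rw [hv] at hmem
  have h1 := smul_mem_coneOn (r := 1 / 2) (by norm_num)
    (conj_mem_coneOn (Matrix.fromCols (1 : Matrix I I ℂ) 1) hmem)
  have h2 := smul_mem_coneOn (r := 1 / 2) (by norm_num)
    (conj_mem_coneOn (Matrix.fromCols (1 : Matrix I I ℂ) (-1)) hmem)
  rw [Matrix.conjTranspose_fromCols_eq_fromRows_conjTranspose, fromCols_triple_fromRows] at h1 h2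
  simp only [Matrix.conjTranspose_neg, Matrix.conjTranspose_one, neg_triple, triple_neg_right,
    one_triple_one, neg_neg] at h1 h2
  set u : Matrix I I (⨂[ℂ] t, V t) := ((1 / 2 : ℝ) : ℂ) • (a + b) with hu
  have hp : v + u = ((1 / 2 : ℝ) : ℂ) • (a + v + (v + b)) := by
    rw [show a + v + (v + b) = (v + v) + (a + b) by abel, smul_add, half_smul_add_self]
  have hm : u - v = ((1 / 2 : ℝ) : ℂ) • (a + -v + (-v + b)) := by
    rw [show a + -v + (-v + b) = (a + b) - (v + v) by abel, smul_sub, half_smul_add_self]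
  rw [← hp] at h1
  rw [← hm] at h2
  refine ⟨u, ?_, ?_, h1, h2⟩
  · have h3 := smul_mem_coneOn (r := 1 / 2) (by norm_num) (h.add_mem_coneOn h1 h2)
    rwa [show v + u + (u - v) = u + u by abel, half_smul_add_self] at h3
  · have h3 := hl.add_le a b
    have h4 := hl.smul_eq ((1 / 2 : ℝ) : ℂ) (a + b)
    rw [Complex.norm_real, Real.norm_of_nonneg (by norm_num)] at h4
    rw [hu, h4]
    linarith

end BigLambda

/-! ### Return to matrices indexed by `Fin n`, and matrix regularity with closed cones. -/

theorem bigLambdaNorm_eq (n : ℕ) (z : Matrix (Fin n) (Fin n) (⨂[ℂ] t, V t)) :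
    L.bigLambdaNorm N K n z = L.bigLambdaNormOn N K (Fin n) z := by
  have key : ∀ u u' : Matrix (Fin n) (Fin n) (⨂[ℂ] t, V t),
      blockMat u z zᴴ u' ∈ L.cone K (n + n) ↔
        Matrix.fromBlocks u z zᴴ u' ∈ L.coneOn K (Fin n ⊕ Fin n) := by
    intro u u'
    constructor
    · intro h
      have h1 := submatrix_mem_coneOn (I := Fin n ⊕ Fin n) finSumFinEquiv
        (show blockMat u z zᴴ u' ∈ L.coneOn K (Fin (n + n)) from h)
      simpa [blockMat] using h1
    · exact fun h => submatrix_mem_coneOn (I := Fin (n + n)) finSumFinEquiv.symm h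
  simp only [bigLambdaNorm, key]
  rfl

theorem Admissible.isMatrixRegular_bigLambdaNorm (h : L.Admissible N K) :
    IsMatrixRegular (fun n => L.bigLambdaNorm N K n) (fun n => L.closedCone N K n) := by
  have hM := h.ruanFamily_bigLambdaNormOn
  have hN : (fun n => L.bigLambdaNorm N K n) = fun n => L.bigLambdaNormOn N K (Fin n) := by
    funext n z
    exact bigLambdaNorm_eq n z
  have hK : (fun n => L.closedCone N K n) = fun n =>
      normClosure (L.bigLambdaNormOn N K (Fin n)) (L.coneOn K (Fin n)) := by
    funext n
    exact congrArg (fun M => normClosure M (L.cone K n)) (congrFun hN n)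
  rw [hN, hK]
  have hsub : ∀ {n : ℕ} {c : Matrix (Fin n) (Fin n) (⨂[ℂ] t, V t)}, c ∈ L.coneOn K (Fin n) →
      c ∈ normClosure (L.bigLambdaNormOn N K (Fin n)) (L.coneOn K (Fin n)) := by
    intro n c hc ε hε
    exact ⟨c, hc, by rwa [sub_self, h.bigLambdaNormOn_zero]⟩
  have hstar : ∀ {n : ℕ} (v : Matrix (Fin n) (Fin n) (⨂[ℂ] t, V t)),
      L.bigLambdaNormOn N K (Fin n) vᴴ = L.bigLambdaNormOn N K (Fin n) v := fun v =>
    le_antisymm (h.bigLambdaNormOn_conjTranspose_le v)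
      (by simpa using h.bigLambdaNormOn_conjTranspose_le vᴴ)
  refine
    { add_le := fun n v w => hM.add_le v w
      smul_eq := fun n c v => hM.smul_eq c v
      eq_zero := fun n v hv => h.eq_zero_of_bigLambdaNormOn_eq_zero hv
      sum_eq := fun p q v w => (hM.reindex_eq finSumFinEquiv _).trans (hM.sum_eq v w)
      sandwich_le := fun p q α v β => hM.triple_le (Fin p) (Fin q) α v β
      isSelfAdjoint := ?_
      zero_mem := fun n => hsub h.zero_mem_coneOn
      add_mem := ?_
      smul_mem := ?_
      conj_mem := ?_
      star_isometry := fun n v => hstar v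
      closed := ?_
      norm_le := ?_
      exists_dominating := ?_ }
  · intro n v hv
    rw [← sub_eq_zero]
    refine h.eq_zero_of_bigLambdaNormOn_eq_zero (le_antisymm ?_ (h.bigLambdaNormOn_nonneg _))
    refine le_of_forall_pos_le_add fun ε hε => ?_
    obtain ⟨c, hc, hvc⟩ := hv (ε / 2) (by positivity)
    have h1 : vᴴ - v = (v - c)ᴴ - (v - c) := by
      rw [Matrix.conjTranspose_sub, h.conjTranspose_eq_of_mem_coneOn hc]
      abel
    have h2 := hM.sub_le (v - c)ᴴ (v - c)
    rw [hstar] at h2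
    rw [h1]
    linarith
  · intro n v hv w hw ε hε
    obtain ⟨c, hc, hvc⟩ := hv (ε / 2) (by positivity)
    obtain ⟨d, hd, hwd⟩ := hw (ε / 2) (by positivity)
    refine ⟨c + d, h.add_mem_coneOn hc hd, ?_⟩
    have h1 := hM.add_le (v - c) (w - d)
    rw [add_sub_add_comm]
    linarith
  · intro n r hr v hv ε hε
    obtain ⟨c, hc, hvc⟩ := hv (ε / (r + 1)) (by positivity)
    refine ⟨(r : ℂ) • c, smul_mem_coneOn hr hc, ?_⟩
    rw [← smul_sub, hM.smul_eq, Complex.norm_real, Real.norm_of_nonneg hr]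
    rw [lt_div_iff₀ (by positivity)] at hvc
    have := h.bigLambdaNormOn_nonneg (v - c)
    nlinarith
  · intro n p A v hv ε hε
    have hA := opNorm_nonneg A
    obtain ⟨c, hc, hvc⟩ := hv (ε / (opNorm A ^ 2 + 1)) (by positivity)
    refine ⟨triple Aᴴ c A, ?_, ?_⟩
    · have := conj_mem_coneOn Aᴴ hc
      rwa [Matrix.conjTranspose_conjTranspose] at this
    · have h1 := hM.triple_le (Fin p) (Fin n) Aᴴ (v - c) A
      rw [opNorm_conjTranspose] at h1
      rw [sandwich_eq_triple, ← triple_sub]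
      rw [lt_div_iff₀ (by positivity)] at hvc
      have := h.bigLambdaNormOn_nonneg (v - c)
      nlinarith
  · intro n v hv ε hε
    obtain ⟨w, hw, hvw⟩ := hv (ε / 2) (by positivity)
    obtain ⟨c, hc, hwc⟩ := hw (ε / 2) (by positivity)
    refine ⟨c, hc, ?_⟩
    have h1 := hM.add_le (v - w) (w - c)
    rw [sub_add_sub_cancel] at h1
    linarith
  · intro n v hv u _ hvu huv
    refine le_of_forall_pos_le_add fun ε hε => ?_
    obtain ⟨c, hc, hc'⟩ := hvu (ε / 3) (by positivity)
    obtain ⟨d, hd, hd'⟩ := huv (ε / 3) (by positivity)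
    have h2 : ((1 / 2 : ℝ) : ℂ) + ((1 / 2 : ℝ) : ℂ) = 1 := by norm_num
    have hsplit : ∀ x : Matrix (Fin n) (Fin n) (⨂[ℂ] t, V t),
        ((1 / 2 : ℝ) : ℂ) • x + ((1 / 2 : ℝ) : ℂ) • x = x := by
      intro x
      rw [← add_smul, h2, one_smul]
    -- The sum and difference `v + u`, `u - v` lie only in the closed cone. With approximants `c`,
    -- `d` from the algebraic cone, `v'` and `u'` are the perturbations satisfying `v' + u' = c` and
    -- `u' - v' = d` exactly.
    set v' := ((1 / 2 : ℝ) : ℂ) • (c - d) with hv'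
    set u' := ((1 / 2 : ℝ) : ℂ) • (c + d) with hu'
    have hadd : v' + u' = c := by
      conv_rhs => rw [← hsplit c]
      rw [hv', hu', smul_sub, smul_add]
      abel
    have hdiff : u' - v' = d := by
      conv_rhs => rw [← hsplit d]
      rw [hv', hu', smul_sub, smul_add]
      abel
    have hhalf : ∀ x : Matrix (Fin n) (Fin n) (⨂[ℂ] t, V t),
        L.bigLambdaNormOn N K (Fin n) (((1 / 2 : ℝ) : ℂ) • x) =
          1 / 2 * L.bigLambdaNormOn N K (Fin n) x := by
      intro x
      have := hM.smul_eq ((1 / 2 : ℝ) : ℂ) x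
      rwa [Complex.norm_real, Real.norm_of_nonneg (by norm_num)] at this
    have e1 : v - v' = ((1 / 2 : ℝ) : ℂ) • ((v + u - c) - (u - v - d)) := by
      conv_lhs => rw [← hsplit v]
      rw [hv']
      simp only [smul_sub, smul_add]
      abel
    have e2 : u' - u = ((1 / 2 : ℝ) : ℂ) • (-(v + u - c) - (u - v - d)) := by
      conv_lhs => rw [← hsplit u]
      rw [hu']
      simp only [smul_sub, smul_add, smul_neg]
      abel
    have n1 : L.bigLambdaNormOn N K (Fin n) (v - v') ≤ ε / 3 := by
      have := hM.sub_le (v + u - c) (u - v - d)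
      rw [e1, hhalf]
      linarith
    have n2 : L.bigLambdaNormOn N K (Fin n) (u' - u) ≤ ε / 3 := by
      have h3 := hM.sub_le (-(v + u - c)) (u - v - d)
      rw [hM.neg_eq] at h3
      rw [e2, hhalf]
      linarith
    have n3 := hM.add_le (v - v') v'
    rw [sub_add_cancel] at n3
    have n4 := hM.add_le (u' - u) u
    rw [sub_add_cancel] at n4
    have hus : u'ᴴ = u' := by
      have hu2 : u' = ((1 / 2 : ℝ) : ℂ) • (c + d) := hu'
      exact h.conjTranspose_eq_of_mem_coneOn (K := K)
        (by rw [hu2]; exact smul_mem_coneOn (by norm_num) (h.add_mem_coneOn hc hd))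
    have n5 : L.bigLambdaNormOn N K (Fin n) v' ≤
        L.bigLambdaNormOn N K (Fin n) u' + ε / 3 := by
      -- Since domination bounds only by a `λ`-norm, `u'` is replaced by some `b ≥ u'` whose
      -- `λ`-norm is nearly the `Λ`-norm of `u'`; `b` still dominates `v'`.
      obtain ⟨b, -, hb, -, hub⟩ := h.exists_dominating_of_lt hus
        (c := L.bigLambdaNormOn N K (Fin n) u' + ε / 3) (by linarith)
      refine (h.bigLambdaNormOn_le_of_dominated (u := b) ?_ ?_).trans hb.le
      · have : v' + b = (v' + u') + (b - u') := by abel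
        rw [this, hadd]
        exact h.add_mem_coneOn hc hub
      · have : b - v' = (u' - v') + (b - u') := by abel
        rw [this, hdiff]
        exact h.add_mem_coneOn hd hub
    linarith
  · intro n v hv hlt
    obtain ⟨u, hu, hu1, hadd, hdiff⟩ := h.exists_dominating_of_lt hv hlt
    refine ⟨u, hsub hu, ?_, hsub hadd, hsub hdiff⟩
    -- Since `u` dominates itself, its `Λ`-norm is at most its `λ`-norm.
    refine (h.bigLambdaNormOn_le_of_dominated ?_ ?_).trans_lt hu1
    · exact h.add_mem_coneOn hu hu
    · rw [sub_self]
      exact h.zero_mem_coneOn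

end MatrixProducts

end

end LambdaTensor

end

theorem mainTheorem1 {m : ℕ} (hm : 0 < m) {V : Fin m → Type*}
    [∀ t, AddCommGroup (V t)] [∀ t, Module ℂ (V t)]
    [∀ t, StarAddMonoid (V t)] [∀ t, StarModule ℂ (V t)]
    (N : ∀ t, ∀ n : ℕ, Matrix (Fin n) (Fin n) (V t) → ℝ)
    (K : ∀ t, ∀ n : ℕ, Set (Matrix (Fin n) (Fin n) (V t)))
    (hV : ∀ t, LambdaTensor.IsMatrixRegular (N t) (K t))
    (L : LambdaTensor.MatrixProducts m)
    (hE1 : L.E1) (hE2 : L.E2) (hE3 : L.E3)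
    (hO1 : L.O1) (hO2 : L.O2) (hO3 : L.O3) :
    LambdaTensor.IsMatrixRegular
        (fun n => L.bigLambdaNorm N K n) (fun n => L.closedCone N K n) ∧
      L.IsSubcross N (fun n => L.bigLambdaNorm N K n) := by
  have h : L.Admissible N K := ⟨hV, hE1, hE2, hE3, hO1, hO2, hO3⟩
  refine ⟨h.isMatrixRegular_bigLambdaNorm, fun j hj v => ?_⟩
  refine (LambdaTensor.MatrixProducts.bigLambdaNorm_eq _ _).trans_le ?_
  exact h.bigLambdaNormOn_tensor_le hj v
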